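/- Let $z_{x^i}$ and $z_{x^iy}$ ($i\ge 0$) be the jet coordinates on the constant astigmatism equation $z_{yy}+(1/z)_{xx}+2=0$ with $z\neq 0$, where $$D_x=\partial_x+\sum_{i\ge0}\big(z_{x^{i+1}}\partial_{z_{x^i}}+z_{x^{i+1}y}\partial_{z_{x^iy}}\big),\qquad D_y=\partial_y+\sum_{i\ge0}\big(z_{x^{i}y}\partial_{z_{x^i}}+z_{x^iyy}\,\partial_{z_{x^iy}}\big),$$ $z_{yy}:=-D_x^2(1/z)-2$ and $z_{x^iyy}:=-D_x^{i+2}(1/z)$ for $i>0$. Put $$K_1=-\tfrac{z_y}4,\quad L_1=-\tfrac{z_x}{4z^2}+\tfrac x2,\quad K_2=-\tfrac{xz_y}2,\quad L_2=-\tfrac{xz_x}{2z^2}-\tfrac1{2z}+\tfrac{x^2}2,$$ $$\bar K_1=\tfrac{z_x}{4z^2},\quad \bar L_1=\tfrac{z_y}4+\tfrac y2,\quad \bar K_2=\tfrac{yz_x}{2z^2},\quad \bar L_2=\tfrac{yz_y}2-\tfrac z2+\tfrac{y^2}2.$$ Let $u_n,v_n,w_n$ ($n\ge1$) be further independent variables,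 let $u_0=1$, $v_0=w_0=0$, $\bar u_0=1$, and for $k\ge 0$ $$\bar u_{k+1}=\tfrac{1+xy}2\sum_{i=0}^k u_i\bar u_{k-i}-\tfrac y2\sum_{i=0}^k\bar u_iv_{k-i}+\tfrac12\sum_{i=0}^k(v_i-xu_i)w_{k-i}-\sum_{i=1}^{k+1}u_i\bar u_{k-i+1}.$$ Consider the covering with potentials $u_n,v_n,w_n$, $n\ge1$, defined by $$\begin{aligned} u_{n,x}&=K_1u_{n-1}+\tfrac12(K_1+zL_1)\sum_{i=0}^{n-2}u_i-\tfrac14z\sum_{i=0}^{n-2}v_i,\\ u_{n,y}&=L_1u_{n-1}-\tfrac12v_{n-1}+\tfrac12\big(L_1+\tfrac{K_1}z\big)\sum_{i=0}^{n-2}u_i-\tfrac14\sum_{i=0}^{n-2}v_i,\\ v_{n,x}&=K_2u_{n-1}-K_1v_{n-1}+\tfrac12(K_2+zL_2)\sum_{i=0}^{n-2}u_i-\tfrac12(K_1+zL_1)\sum_{i=0}^{n-2}v_i,\\ v_{n,y}&=L_2u_{n-1}-L_1v_{n-1}+\tfrac12\big(L_2+\tfrac{K_2}z\big)\sum_{i=0}^{n-2}u_i-\tfrac12\big(L_1+\tfrac{K_1}z\big)\sum_{i=0}^{n-2}v_i,\\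 w_{n,x}&=\bar L_2\bar u_{n-1}-\bar L_1w_{n-1}+\tfrac12(\bar L_2+z\bar K_2)\sum_{i=0}^{n-2}\bar u_i-\tfrac12(\bar L_1+z\bar K_1)\sum_{i=0}^{n-2}w_i,\\ w_{n,y}&=\bar K_2\bar u_{n-1}-\bar K_1w_{n-1}+\tfrac12\big(\bar K_2+\tfrac{\bar L_2}z\big)\sum_{i=0}^{n-2}\bar u_i-\tfrac12\big(\bar K_1+\tfrac{\bar L_1}z\big)\sum_{i=0}^{n-2}w_i, \end{aligned}$$ with total derivatives $$\tilde D_x=D_x+\sum_{n\ge1}\big(u_{n,x}\partial_{u_n}+v_{n,x}\partial_{v_n}+w_{n,x}\partial_{w_n}\big),\qquad \tilde D_y=D_y+\sum_{n\ge1}\big(u_{n,y}\partial_{u_n}+v_{n,y}\partial_{v_n}+w_{n,y}\partial_{w_n}\big).$$ **Proposition.** Let $U$ be a connected open set (in the product topology) of points of the space with coordinates $x,y,z_{x^i},z_{x^iy},u_n,v_n,w_n$, on which $z\ne0$, and let $F$ be a function on $U$ which is a smooth function of finitely many of these variables. If $\tilde D_xF=\tilde D_yF=0$ on $U$, then $F$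 is constant on $U$. In particular, the covering is differentially connected over each of the two components $\{z>0\}$ and $\{z<0\}$: every function that is a smooth function of finitely many of the variables there and is annihilated by $\tilde D_x$ and $\tilde D_y$ is constant. -/

import Mathlib

namespace ConstAstig

/-- The independent variables on the covering of the constant astigmatism equation:
`z i` is the jet coordinate `z_{x…x}` (`i` letters `x`), `zy i` is `z_{x…xy}`
(`i` letters `x` and one letter `y`); these are the jet coordinates whose monomial is not
divisible by `y²`. The constructors `u n`, `v n`, `w n` are the potentials of index `n + 1`,
since the potentials of index `0` are constants and not variables. -/
inductive Coord : Type
  | x : Coord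
  | y : Coord
  | z (i : ℕ) : Coord
  | zy (i : ℕ) : Coord
  | u (n : ℕ) : Coord
  | v (n : ℕ) : Coord
  | w (n : ℕ) : Coord
  deriving DecidableEq

/-- Points of the total space, given by the values of all the variables. -/
abbrev Pt : Type := Coord → ℝ

/-- The partial derivative `∂F/∂c` at `P`. -/
noncomputable def pderiv (c : Coord) (F : Pt → ℝ) (P : Pt) : ℝ :=
  deriv (fun t : ℝ => F (Function.update P c t)) (P c)

/-- The vector field `∑_c a_c ∂/∂c` acting on functions. The sum over `c` has only finitely many
nonzero terms if `F` is a function of finitely many variables. -/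
noncomputable def vectorField (a : Coord → Pt → ℝ) (F : Pt → ℝ) (P : Pt) : ℝ :=
  ∑ᶠ c : Coord, a c P * pderiv c F P

/-! ### The constant astigmatism equation `z_yy + (1/z)_xx + 2 = 0` -/

/-- Coefficients of the total derivative `D_x` restricted to the equation (no potentials). -/
def jetXCoeff : Coord → Pt → ℝ
  | .x, _ => 1
  | .y, _ => 0
  | .z i, P => P (.z (i + 1))
  | .zy i, P => P (.zy (i + 1))
  | .u _, _ => 0
  | .v _, _ => 0
  | .w _, _ => 0

/-- The total derivative `D_x` restricted to the equation. -/
noncomputable def jetDx : (Pt → ℝ) → Pt → ℝ := vectorField jetXCoeff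

/-- The function assigned to the jet coordinate `z_{x…xyy}` (`i` letters `x`): `z_yy` is
`-(1/z)_xx - 2` and the others are the differential consequences `-D_x^{i+2} (1/z)`. -/
noncomputable def zyy : ℕ → Pt → ℝ
  | 0, P => -(jetDx^[2] (fun Q => 1 / Q (.z 0))) P - 2
  | i + 1, P => -(jetDx^[i + 3] (fun Q => 1 / Q (.z 0))) P

/-! ### The coefficients `K_i`, `L_i` and their duals -/

noncomputable def K₁ (P : Pt) : ℝ := -P (.zy 0) / 4
noncomputable def L₁ (P : Pt) : ℝ := -P (.z 1) / (4 * P (.z 0) ^ 2) + P .x / 2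
noncomputable def K₂ (P : Pt) : ℝ := -(P .x * P (.zy 0)) / 2
noncomputable def L₂ (P : Pt) : ℝ :=
  -(P .x * P (.z 1)) / (2 * P (.z 0) ^ 2) - 1 / (2 * P (.z 0)) + P .x ^ 2 / 2

noncomputable def Kbar₁ (P : Pt) : ℝ := P (.z 1) / (4 * P (.z 0) ^ 2)
noncomputable def Lbar₁ (P : Pt) : ℝ := P (.zy 0) / 4 + P .y / 2
noncomputable def Kbar₂ (P : Pt) : ℝ := P .y * P (.z 1) / (2 * P (.z 0) ^ 2)
noncomputable def Lbar₂ (P : Pt) : ℝ := P .y * P (.zy 0) / 2 - P (.z 0) / 2 + P .y ^ 2 / 2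

/-! ### The potentials, now with their proper index: `u_0 = 1`, `v_0 = w_0 = 0` -/

def uPot (P : Pt) : ℕ → ℝ
  | 0 => 1
  | n + 1 => P (.u n)

def vPot (P : Pt) : ℕ → ℝ
  | 0 => 0
  | n + 1 => P (.v n)

def wPot (P : Pt) : ℕ → ℝ
  | 0 => 0
  | n + 1 => P (.w n)

/-- The functions `ū_n`, given by `ū_0 = 1` and
`ū_{k+1} = (1 + xy)/2 ∑_{i=0}^k u_i ū_{k-i} - y/2 ∑_{i=0}^k ū_i v_{k-i}
  + 1/2 ∑_{i=0}^k (v_i - x u_i) w_{k-i} - ∑_{i=1}^{k+1} u_i ū_{k-i+1}`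
(the last sum is written with `i + 1` in place of `i`). -/
noncomputable def ubar (P : Pt) : ℕ → ℝ
  | 0 => 1
  | k + 1 =>
      (1 + P .x * P .y) / 2 * ∑ i : Fin (k + 1), uPot P (i : ℕ) * ubar P (k - (i : ℕ))
      - P .y / 2 * ∑ i : Fin (k + 1), ubar P (i : ℕ) * vPot P (k - (i : ℕ))
      + 1 / 2 * ∑ i : Fin (k + 1), (vPot P (i : ℕ) - P .x * uPot P (i : ℕ)) * wPot P (k - (i : ℕ))
      - ∑ i : Fin (k + 1), uPot P ((i : ℕ) + 1) * ubar P (k - (i : ℕ))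
termination_by n => n
decreasing_by all_goals omega

/-! ### The covering. In each formula the potential differentiated has index `n + 1`, so that the
sums over `Finset.range n` run over the indices from `0` to `(n + 1) - 2`. -/

noncomputable def ux (n : ℕ) (P : Pt) : ℝ :=
  K₁ P * uPot P n
    + 1 / 2 * (K₁ P + P (.z 0) * L₁ P) * ∑ i ∈ Finset.range n, uPot P i
    - 1 / 4 * P (.z 0) * ∑ i ∈ Finset.range n, vPot P i

noncomputable def uy (n : ℕ) (P : Pt) : ℝ :=
  L₁ P * uPot P n - 1 / 2 * vPot P n
    + 1 / 2 * (L₁ P + K₁ P / P (.z 0)) * ∑ i ∈ Finset.range n, uPot P i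
    - 1 / 4 * ∑ i ∈ Finset.range n, vPot P i

noncomputable def vx (n : ℕ) (P : Pt) : ℝ :=
  K₂ P * uPot P n - K₁ P * vPot P n
    + 1 / 2 * (K₂ P + P (.z 0) * L₂ P) * ∑ i ∈ Finset.range n, uPot P i
    - 1 / 2 * (K₁ P + P (.z 0) * L₁ P) * ∑ i ∈ Finset.range n, vPot P i

noncomputable def vy (n : ℕ) (P : Pt) : ℝ :=
  L₂ P * uPot P n - L₁ P * vPot P n
    + 1 / 2 * (L₂ P + K₂ P / P (.z 0)) * ∑ i ∈ Finset.range n, uPot P i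
    - 1 / 2 * (L₁ P + K₁ P / P (.z 0)) * ∑ i ∈ Finset.range n, vPot P i

noncomputable def wx (n : ℕ) (P : Pt) : ℝ :=
  Lbar₂ P * ubar P n - Lbar₁ P * wPot P n
    + 1 / 2 * (Lbar₂ P + P (.z 0) * Kbar₂ P) * ∑ i ∈ Finset.range n, ubar P i
    - 1 / 2 * (Lbar₁ P + P (.z 0) * Kbar₁ P) * ∑ i ∈ Finset.range n, wPot P i

noncomputable def wy (n : ℕ) (P : Pt) : ℝ :=
  Kbar₂ P * ubar P n - Kbar₁ P * wPot P n
    + 1 / 2 * (Kbar₂ P + Lbar₂ P / P (.z 0)) * ∑ i ∈ Finset.range n, ubar P i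
    - 1 / 2 * (Kbar₁ P + Lbar₁ P / P (.z 0)) * ∑ i ∈ Finset.range n, wPot P i

/-- Coefficients of the total derivative of the covering with respect to `x`. -/
noncomputable def xCoeff : Coord → Pt → ℝ
  | .x, _ => 1
  | .y, _ => 0
  | .z i, P => P (.z (i + 1))
  | .zy i, P => P (.zy (i + 1))
  | .u n, P => ux n P
  | .v n, P => vx n P
  | .w n, P => wx n P

/-- Coefficients of the total derivative of the covering with respect to `y`. -/
noncomputable def yCoeff : Coord → Pt → ℝ
  | .x, _ => 0
  | .y, _ => 1
  | .z i, P => P (.zy i)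
  | .zy i, P => zyy i P
  | .u n, P => uy n P
  | .v n, P => vy n P
  | .w n, P => wy n P

/-- The total derivative of the covering with respect to `x`. -/
noncomputable def totalDx : (Pt → ℝ) → Pt → ℝ := vectorField xCoeff

/-- The total derivative of the covering with respect to `y`. -/
noncomputable def totalDy : (Pt → ℝ) → Pt → ℝ := vectorField yCoeff

/-- On the open set `U`, `F` is a smooth function of finitely many of the variables (those in the
finite set `s`). The values of `F` outside `U` are irrelevant. -/
def IsSmoothFinitaryOn (F : Pt → ℝ) (U : Set Pt) : Prop :=
  ∃ (s : Finset Coord) (f : (s → ℝ) → ℝ),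
    ContDiffOn ℝ (⊤ : ℕ∞) f (s.restrict '' U) ∧ ∀ P ∈ U, F P = f (s.restrict P)

/-- Differential connectedness of the covering over the domain `U`: the smooth functions of
finitely many variables annihilated by both total derivatives are the constants. -/
def DifferentiallyConnectedOn (U : Set Pt) : Prop :=
  ∀ F : Pt → ℝ, IsSmoothFinitaryOn F U →
    (∀ P ∈ U, totalDx F P = 0) → (∀ P ∈ U, totalDy F P = 0) →
    ∃ c : ℝ, ∀ P ∈ U, F P = c

end ConstAstig

/-!
The idea is to let the Lie algebra of all vector fields annihilating `F` grow until it contains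
every partial derivative.

The smooth functions of finitely many variables on a domain form an algebra with commuting partial
derivatives (`domainAlgebra`, a `CoordinateAlgebra`), and the vector fields
annihilating `F` are closed under brackets and under multiplication by functions. The bracket of
the total derivative in the direction `x` with `∂/∂z_{i+2}` is `∂/∂z_{i+1}`, and similarly for the
coordinates `z_{x…xy}`; as `F` depends on finitely many variables, descending induction shows that
it depends on `x`, `y`, `z` and the potentials only (`pd_z_succ_eq_zero`, `pd_zy_eq_zero`). In
particular the components of the total derivative in the direction `y` along the `z_{x…xy}` play
no role.

The potentials are then assembled into power series `u`, `v`, `w`, `ū` in a parameter `λ`. The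
recursion for `ū` says that the matrix with columns `(u, v - x u)` and `(w - y ū, ū)`, its entries
weighted by series in `λ`, has determinant `1` (`determinant_eq_one`), and the total derivatives multiply it
from the left by traceless matrices (`actsBy_dx`, `actsBy_dy`). Here `x` and `y` are, up to sign,
the constant terms of `v - x u` and `w - y ū`, so they are treated like the potentials. The
coefficients of `z_x` and `z_y` in the total derivatives, and what remains of them, are separately
annihilating vector fields: one acts by the diagonal matrix with entries `∓a/2`, where
`a = λ/2 + ⋯` is the series `serA`, one of them is `∂/∂z` up to a diagonal matrix, and two act by
off-diagonal matrices (`exists_annihilates_lower`, `exists_annihilates_upper`). Bracketing the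
last two repeatedly with the first multiplies them by powers of `a`, and their brackets with each
other supply diagonal matrices divisible by any given power of `λ` (`exists_annihilates_pow`,
`exists_annihilates_diagonal_pow`). The lowest order terms of these fields isolate, one after the
other, the derivatives of `F` by the last three potentials on which it could depend
(`pd_potential_step`), so that `F` depends on no potential; finally it depends on none of `z`,
`x`, `y`, and it is constant by connectedness.
-/

namespace ConstAstig

/-! ### Smooth functions of finitely many variables -/

section FinitelyManyVariables

variable {U : Set Pt} {s : Finset Coord} {F G : Pt → ℝ} {f : (s → ℝ) → ℝ} {P : Pt}

theorem restrict_update (s : Finset Coord) (P : Pt) (c : Coord) (t : ℝ) :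
    s.restrict (Function.update P c t) =
      s.restrict P + (t - P c) • s.restrict (Pi.single c (1 : ℝ) : Pt) := by
  ext i
  by_cases h : (i : Coord) = c
  · simp [Finset.restrict, h]
  · simp [Finset.restrict, h]

theorem restrict_single_of_notMem {c : Coord} (h : c ∉ s) :
    s.restrict (Pi.single c (1 : ℝ) : Pt) = 0 := by
  ext i
  have : (i : Coord) ≠ c := fun hi => h (hi ▸ i.2)
  simp [Finset.restrict, this]

theorem isOpen_image_restrict (s : Finset Coord) (hU : IsOpen U) : IsOpen (s.restrict '' U) := by
  have h : IsOpenMap (s.restrict : Pt → (s → ℝ)) :=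
    isOpenMap_fst.comp (Homeomorph.piEquivPiSubtypeProd (fun c => c ∈ s) _).isOpenMap
  exact h U hU

theorem eventually_update_mem (hU : IsOpen U) (hP : P ∈ U) (c : Coord) :
    ∀ᶠ t in nhds (P c), Function.update P c t ∈ U := by
  have h : Filter.Tendsto (fun t : ℝ => Function.update P c t) (nhds (P c)) (nhds P) := by
    have : Continuous fun t : ℝ => Function.update P c t := by fun_prop
    simpa using this.tendsto (P c)
  exact h.eventually (hU.mem_nhds hP)

theorem differentiableAt_of_contDiffOn (hU : IsOpen U)
    (hf : ContDiffOn ℝ (⊤ : ℕ∞) f (s.restrict '' U)) (hP : P ∈ U) :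
    DifferentiableAt ℝ f (s.restrict P) :=
  ((hf.contDiffAt ((isOpen_image_restrict s hU).mem_nhds ⟨P, hP, rfl⟩)).differentiableAt
    (by simp))

theorem hasDerivAt_update (hU : IsOpen U)
    (hf : ContDiffOn ℝ (⊤ : ℕ∞) f (s.restrict '' U)) (hF : ∀ P ∈ U, F P = f (s.restrict P))
    (hP : P ∈ U) (c : Coord) :
    HasDerivAt (fun t => F (Function.update P c t))
      (fderiv ℝ f (s.restrict P) (s.restrict (Pi.single c (1 : ℝ) : Pt))) (P c) := by
  have h1 : HasDerivAt (fun t : ℝ => s.restrict P +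
      (t - P c) • s.restrict (Pi.single c (1 : ℝ) : Pt))
      (s.restrict (Pi.single c (1 : ℝ) : Pt)) (P c) := by
    simpa using (((hasDerivAt_id (P c)).sub_const (P c)).smul_const
      (s.restrict (Pi.single c (1 : ℝ) : Pt))).const_add (s.restrict P)
  have h2 : HasFDerivAt f (fderiv ℝ f (s.restrict P))
      (s.restrict P + (P c - P c) • s.restrict (Pi.single c (1 : ℝ) : Pt)) := by
    simpa using (differentiableAt_of_contDiffOn hU hf hP).hasFDerivAt
  refine (h2.comp_hasDerivAt (P c) h1).congr_of_eventuallyEq ?_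
  filter_upwards [eventually_update_mem hU hP c] with t ht
  simp [hF _ ht, restrict_update]

theorem pderiv_eq_fderiv (hU : IsOpen U)
    (hf : ContDiffOn ℝ (⊤ : ℕ∞) f (s.restrict '' U)) (hF : ∀ P ∈ U, F P = f (s.restrict P))
    (hP : P ∈ U) (c : Coord) :
    pderiv c F P = fderiv ℝ f (s.restrict P) (s.restrict (Pi.single c (1 : ℝ) : Pt)) :=
  (hasDerivAt_update hU hf hF hP c).deriv

theorem contDiffOn_fderiv_apply (hU : IsOpen U)
    (hf : ContDiffOn ℝ (⊤ : ℕ∞) f (s.restrict '' U)) (e : s → ℝ) :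
    ContDiffOn ℝ (⊤ : ℕ∞) (fun p => fderiv ℝ f p e) (s.restrict '' U) :=
  (hf.fderiv_of_isOpen (isOpen_image_restrict s hU) (by simp)).clm_apply contDiffOn_const

theorem IsSmoothFinitaryOn.pderiv (hU : IsOpen U) (hF : IsSmoothFinitaryOn F U) (c : Coord) :
    IsSmoothFinitaryOn (pderiv c F) U := by
  obtain ⟨s, f, hf, h⟩ := hF
  exact ⟨s, _, contDiffOn_fderiv_apply hU hf _, fun P hP => pderiv_eq_fderiv hU hf h hP c⟩

theorem IsSmoothFinitaryOn.differentiableAt_update (hU : IsOpen U) (hF : IsSmoothFinitaryOn F U)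
    (hP : P ∈ U) (c : Coord) :
    DifferentiableAt ℝ (fun t => F (Function.update P c t)) (P c) := by
  obtain ⟨s, f, hf, h⟩ := hF
  exact (hasDerivAt_update hU hf h hP c).differentiableAt

theorem pderiv_congr (hU : IsOpen U) (h : ∀ P ∈ U, F P = G P) (hP : P ∈ U) (c : Coord) :
    pderiv c F P = pderiv c G P := by
  refine Filter.EventuallyEq.deriv_eq ?_
  filter_upwards [eventually_update_mem hU hP c] with t ht using h _ ht

theorem IsSmoothFinitaryOn.exists_pderiv_eq_zero (hU : IsOpen U) (hF : IsSmoothFinitaryOn F U) :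
    ∃ s : Finset Coord, ∀ c ∉ s, ∀ P ∈ U, ConstAstig.pderiv c F P = 0 := by
  obtain ⟨s, f, hf, h⟩ := hF
  refine ⟨s, fun c hc P hP => ?_⟩
  rw [pderiv_eq_fderiv hU hf h hP, restrict_single_of_notMem hc, map_zero]

theorem IsSmoothFinitaryOn.pderiv_comm (hU : IsOpen U) (hF : IsSmoothFinitaryOn F U)
    (hP : P ∈ U) (c d : Coord) :
    ConstAstig.pderiv c (ConstAstig.pderiv d F) P =
      ConstAstig.pderiv d (ConstAstig.pderiv c F) P := by
  obtain ⟨s, f, hf, h⟩ := hF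
  have hC : ContDiffAt ℝ (⊤ : ℕ∞) f (s.restrict P) :=
    hf.contDiffAt ((isOpen_image_restrict s hU).mem_nhds ⟨P, hP, rfl⟩)
  have hd : DifferentiableAt ℝ (fderiv ℝ f) (s.restrict P) :=
    (hC.fderiv_right (m := 1) (by norm_cast)).differentiableAt (by simp)
  have key : ∀ c d, ConstAstig.pderiv c (ConstAstig.pderiv d F) P =
      fderiv ℝ (fderiv ℝ f) (s.restrict P) (s.restrict (Pi.single c (1 : ℝ) : Pt))
        (s.restrict (Pi.single d (1 : ℝ) : Pt)) := by
    intro c d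
    rw [pderiv_eq_fderiv hU (contDiffOn_fderiv_apply hU hf _)
      (fun Q hQ => pderiv_eq_fderiv hU hf h hQ d) hP c,
      fderiv_clm_apply hd (differentiableAt_const _)]
    simp
  rw [key, key]
  exact (hC.isSymmSndFDerivAt (by
    rw [minSmoothness_of_isRCLikeNormedField]
    exact WithTop.coe_le_coe.2 (le_top (a := (2 : ℕ∞))))) _ _

/-- A finite set of variables on which a smooth function depends can be enlarged. -/
theorem IsSmoothFinitaryOn.exists_of_subset {s t : Finset Coord} (hst : s ⊆ t)
    {f : (s → ℝ) → ℝ} (hf : ContDiffOn ℝ (⊤ : ℕ∞) f (s.restrict '' U))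
    (hF : ∀ P ∈ U, F P = f (s.restrict P)) :
    ∃ f' : (t → ℝ) → ℝ, ContDiffOn ℝ (⊤ : ℕ∞) f' (t.restrict '' U) ∧
      ∀ P ∈ U, F P = f' (t.restrict P) := by
  refine ⟨fun p => f (fun i => p ⟨i, hst i.2⟩), hf.comp ?_ ?_, hF⟩
  · exact (contDiff_pi.2 fun i => contDiff_apply ℝ ℝ _).contDiffOn
  · rintro _ ⟨P, hP, rfl⟩
    exact ⟨P, hP, rfl⟩

theorem IsSmoothFinitaryOn.map₂ (hF : IsSmoothFinitaryOn F U) (hG : IsSmoothFinitaryOn G U)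
    {op : ℝ → ℝ → ℝ} (hop : ContDiff ℝ (⊤ : ℕ∞) fun p : ℝ × ℝ => op p.1 p.2) :
    IsSmoothFinitaryOn (fun P => op (F P) (G P)) U := by
  classical
  obtain ⟨s, f, hf, h⟩ := hF
  obtain ⟨t, g, hg, k⟩ := hG
  obtain ⟨f', hf', h'⟩ := exists_of_subset (Finset.subset_union_left (s₂ := t)) hf h
  obtain ⟨g', hg', k'⟩ := exists_of_subset (Finset.subset_union_right (s₁ := s)) hg k
  exact ⟨s ∪ t, fun p => op (f' p) (g' p), hop.comp_contDiffOn (hf'.prodMk hg'),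
    fun P hP => by simp only [h' P hP, k' P hP]⟩

theorem isSmoothFinitaryOn_const (r : ℝ) : IsSmoothFinitaryOn (fun _ => r) U :=
  ⟨∅, fun _ => r, contDiffOn_const, fun _ _ => rfl⟩

theorem isSmoothFinitaryOn_coord (c : Coord) : IsSmoothFinitaryOn (fun P => P c) U :=
  ⟨{c}, fun p => p ⟨c, by simp⟩, (contDiff_apply ℝ ℝ _).contDiffOn, fun _ _ => rfl⟩

theorem isSmoothFinitaryOn_inv_coord {c : Coord} (h : ∀ P ∈ U, P c ≠ 0) :
    IsSmoothFinitaryOn (fun P => (P c)⁻¹) U := by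
  refine ⟨{c}, fun p => (p ⟨c, by simp⟩)⁻¹, (contDiff_apply ℝ ℝ _).contDiffOn.inv ?_,
    fun _ _ => rfl⟩
  rintro _ ⟨P, hP, rfl⟩
  exact h P hP

theorem IsSmoothFinitaryOn.congr (hF : IsSmoothFinitaryOn F U) (h : ∀ P ∈ U, G P = F P) :
    IsSmoothFinitaryOn G U := by
  obtain ⟨s, f, hf, k⟩ := hF
  exact ⟨s, f, hf, fun P hP => (h P hP).trans (k P hP)⟩

/-- On a connected open set, a smooth function of finitely many variables all of whose partial
derivatives vanish is constant. -/
theorem IsSmoothFinitaryOn.exists_eq_const (hU : IsOpen U) (hc : IsPreconnected U)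
    (hF : IsSmoothFinitaryOn F U) (h0 : ∀ c, ∀ P ∈ U, ConstAstig.pderiv c F P = 0) :
    ∃ r : ℝ, ∀ P ∈ U, F P = r := by
  classical
  obtain ⟨s, f, hf, h⟩ := hF
  have hcont : Continuous (s.restrict : Pt → (s → ℝ)) := by
    exact continuous_pi fun i => continuous_apply _
  obtain ⟨r, hr⟩ := (isOpen_image_restrict s hU).exists_is_const_of_fderiv_eq_zero
    (𝕜 := ℝ) (f := f) (hc.image _ hcont.continuousOn) (hf.differentiableOn (by simp)) (by
      rintro _ ⟨P, hP, rfl⟩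
      ext e
      have he : e = ∑ i, e i • s.restrict (Pi.single (i : Coord) (1 : ℝ) : Pt) := by
        ext j
        simp [Finset.restrict, Finset.sum_apply, Pi.single_apply]
      rw [he, map_sum]
      refine Finset.sum_eq_zero fun i _ => ?_
      rw [map_smul, ← pderiv_eq_fderiv hU hf h hP, h0 _ P hP, smul_zero])
  exact ⟨r, fun P hP => (h P hP).trans (hr _ ⟨P, hP, rfl⟩)⟩

end FinitelyManyVariables

/-! ### The differential algebra of a domain -/

section SmoothAlgebra

variable {U : Set Pt}

/-- Extension by zero of a function on `U`. -/
noncomputable def extend (g : U → ℝ) : Pt → ℝ := Function.extend Subtype.val g 0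

@[simp]
theorem extend_apply (g : U → ℝ) (P : U) : extend g P = g P :=
  Subtype.val_injective.extend_apply g 0 P

theorem extend_of_mem (g : U → ℝ) {P : Pt} (hP : P ∈ U) : extend g P = g ⟨P, hP⟩ :=
  extend_apply g ⟨P, hP⟩

/-- The algebra of smooth functions of finitely many variables on `U`. -/
def smoothAlgebra (U : Set Pt) : Subalgebra ℝ (U → ℝ) where
  carrier := {g | IsSmoothFinitaryOn (extend g) U}
  mul_mem' {g h} hg hh := (IsSmoothFinitaryOn.map₂ hg hh (op := (· * ·)) (by fun_prop)).congr
    fun P hP => by simp [extend_of_mem _ hP]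
  add_mem' {g h} hg hh := (IsSmoothFinitaryOn.map₂ hg hh (op := (· + ·)) (by fun_prop)).congr
    fun P hP => by simp [extend_of_mem _ hP]
  algebraMap_mem' r := (isSmoothFinitaryOn_const r).congr
    fun P hP => by simp [extend_of_mem _ hP]

/-- The element of the algebra given by a function on the whole space. -/
noncomputable def smoothAlgebra.mk (F : Pt → ℝ) (hF : IsSmoothFinitaryOn F U) : smoothAlgebra U :=
  ⟨fun P => F P, hF.congr fun P hP => by simp [extend_of_mem _ hP]⟩

/-- The value at a point, as a homomorphism of algebras. -/
def smoothAlgebra.eval (P : U) : smoothAlgebra U →ₐ[ℝ] ℝ :=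
  (Pi.evalAlgHom ℝ (fun _ : U => ℝ) P).comp (smoothAlgebra U).val

theorem smoothAlgebra.eval_apply (P : U) (g : smoothAlgebra U) :
    smoothAlgebra.eval P g = extend g.1 P := by
  rw [extend_apply]; rfl

@[simp]
theorem smoothAlgebra.eval_mk (P : U) (F : Pt → ℝ) (hF : IsSmoothFinitaryOn F U) :
    smoothAlgebra.eval P (smoothAlgebra.mk F hF) = F P := rfl

theorem smoothAlgebra.ext_eval {g h : smoothAlgebra U}
    (H : ∀ P, smoothAlgebra.eval P g = smoothAlgebra.eval P h) : g = h :=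
  Subtype.ext (funext H)

/-- The partial derivative as a derivation of the algebra of smooth functions of finitely many
variables. -/
noncomputable def smoothAlgebra.pd (hU : IsOpen U) (c : Coord) :
    Derivation ℝ (smoothAlgebra U) (smoothAlgebra U) :=
  Derivation.mk'
    { toFun := fun g => smoothAlgebra.mk (pderiv c (extend g.1)) (g.2.pderiv hU c)
      map_add' := fun g h => by
        refine smoothAlgebra.ext_eval fun P => ?_
        rw [map_add]
        simp only [smoothAlgebra.eval_mk]
        rw [pderiv_congr hU (G := fun Q => extend g.1 Q + extend h.1 Q)
          (fun Q hQ => by simp [extend_of_mem _ hQ]) P.2]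
        exact deriv_fun_add (g.2.differentiableAt_update hU P.2 c)
          (h.2.differentiableAt_update hU P.2 c)
      map_smul' := fun r g => by
        refine smoothAlgebra.ext_eval fun P => ?_
        rw [map_smul]
        simp only [smoothAlgebra.eval_mk]
        rw [pderiv_congr hU (G := fun Q => r * extend g.1 Q)
          (fun Q hQ => by simp [extend_of_mem _ hQ]) P.2]
        exact deriv_const_mul r (g.2.differentiableAt_update hU P.2 c) }
    fun g h => by
      refine smoothAlgebra.ext_eval fun P => ?_
      simp only [smul_eq_mul, map_add, map_mul, LinearMap.coe_mk, AddHom.coe_mk,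
        smoothAlgebra.eval_mk]
      rw [pderiv_congr hU (G := fun Q => extend g.1 Q * extend h.1 Q)
          (fun Q hQ => by simp [extend_of_mem _ hQ]) P.2]
      refine (deriv_fun_mul (g.2.differentiableAt_update hU P.2 c)
          (h.2.differentiableAt_update hU P.2 c)).trans ?_
      simp only [Function.update_eq_self, smoothAlgebra.eval_apply]
      unfold pderiv
      ring

theorem smoothAlgebra.eval_pd (hU : IsOpen U) (c : Coord) (g : smoothAlgebra U) (P : U) :
    smoothAlgebra.eval P (smoothAlgebra.pd hU c g) = pderiv c (extend g.1) P := rfl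

theorem smoothAlgebra.pd_mk (hU : IsOpen U) (c : Coord) (F : Pt → ℝ)
    (hF : IsSmoothFinitaryOn F U) (P : U) :
    smoothAlgebra.eval P (smoothAlgebra.pd hU c (smoothAlgebra.mk F hF)) = pderiv c F P := by
  rw [smoothAlgebra.eval_pd]
  exact pderiv_congr hU (fun Q hQ => by simp [smoothAlgebra.mk, extend_of_mem _ hQ]) P.2 c

end SmoothAlgebra

/-! ### Derivations acting coefficientwise on power series -/

section PowerSeries

open PowerSeries

variable {A : Type*} [CommRing A] [Algebra ℝ A]

/-- The coefficientwise extension of a derivation to power series in the parameter. -/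
noncomputable def seriesDerivation (D : Derivation ℝ A A) : Derivation ℝ A⟦X⟧ A⟦X⟧ :=
  Derivation.mk'
    { toFun := fun p => PowerSeries.mk fun n => D (coeff n p)
      map_add' := fun p q => by ext n; simp
      map_smul' := fun r p => by ext n; simp }
    fun p q => by
      ext n
      simp only [LinearMap.coe_mk, AddHom.coe_mk, coeff_mk, smul_eq_mul, map_add, coeff_mul,
        map_sum, Derivation.leibniz, Finset.sum_add_distrib]
      congr 1
      rw [← Finset.Nat.sum_antidiagonal_swap]
      rfl

@[simp]
theorem coeff_seriesDerivation (D : Derivation ℝ A A) (p : A⟦X⟧) (n : ℕ) :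
    coeff n (seriesDerivation D p) = D (coeff n p) :=
  coeff_mk n fun k => D (coeff k p)

@[simp]
theorem seriesDerivation_C (D : Derivation ℝ A A) (a : A) :
    seriesDerivation D (C a) = C (D a) := by
  ext n
  rw [coeff_seriesDerivation, coeff_C, coeff_C]
  split_ifs <;> simp

@[simp]
theorem seriesDerivation_map (D : Derivation ℝ A A) (p : ℝ⟦X⟧) :
    seriesDerivation D (map (algebraMap ℝ A) p) = 0 := by
  ext n; simp

theorem seriesDerivation_mul (D : Derivation ℝ A A) (p q : A⟦X⟧) :
    seriesDerivation D (p * q) = p * seriesDerivation D q + q * seriesDerivation D p :=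
  (seriesDerivation D).leibniz p q

theorem seriesDerivation_lie (D E : Derivation ℝ A A) (p : A⟦X⟧) :
    seriesDerivation ⁅D, E⁆ p =
      seriesDerivation D (seriesDerivation E p) - seriesDerivation E (seriesDerivation D p) := by
  ext n; simp [Derivation.commutator_apply]

theorem seriesDerivation_sub (D E : Derivation ℝ A A) (p : A⟦X⟧) :
    seriesDerivation (D - E) p = seriesDerivation D p - seriesDerivation E p := by
  ext n; simp

theorem seriesDerivation_smul (a : A) (D : Derivation ℝ A A) (p : A⟦X⟧) :
    seriesDerivation (a • D) p = C a * seriesDerivation D p := by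
  ext n; simp

end PowerSeries

/-! ### Vector fields in an algebra with coordinates -/

/-- An algebra of functions of the variables: it carries commuting partial derivatives, each
function depends on finitely many variables only, and `z` is invertible. -/
structure CoordinateAlgebra (A : Type*) [CommRing A] [Algebra ℝ A] where
  /-- the variables as elements of the algebra -/
  coord : Coord → A
  /-- the partial derivatives -/
  pd : Coord → Derivation ℝ A A
  pd_coord : ∀ c d, pd c (coord d) = if d = c then 1 else 0
  pd_comm : ∀ c d F, pd c (pd d F) = pd d (pd c F)
  exists_pd_eq_zero : ∀ F, ∃ s : Finset Coord, ∀ c ∉ s, pd c F = 0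
  /-- the inverse of `z` -/
  zinv : A
  coord_mul_zinv : coord (.z 0) * zinv = 1

namespace CoordinateAlgebra

variable {A : Type*} [CommRing A] [Algebra ℝ A] (𝒞 : CoordinateAlgebra A)

theorem support_subset {F : A} {s : Finset Coord} (hs : ∀ c ∉ s, 𝒞.pd c F = 0) (a : Coord → A) :
    (Function.support fun c => a c * 𝒞.pd c F) ⊆ s := by
  intro c hc
  by_contra h
  exact hc (by simp [hs c h])

theorem finite_support (a : Coord → A) (F : A) :
    (Function.support fun c => a c * 𝒞.pd c F).Finite := by
  obtain ⟨s, hs⟩ := 𝒞.exists_pd_eq_zero F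
  exact s.finite_toSet.subset (𝒞.support_subset hs a)

/-- The vector field with given components, as a derivation. -/
noncomputable def vf (a : Coord → A) : Derivation ℝ A A :=
  Derivation.mk'
    { toFun := fun F => ∑ᶠ c, a c * 𝒞.pd c F
      map_add' := fun F G => by
        simp only [map_add, mul_add]
        exact finsum_add_distrib (𝒞.finite_support a F) (𝒞.finite_support a G)
      map_smul' := fun r F => by
        simp only [Derivation.map_smul, mul_smul_comm, RingHom.id_apply]
        exact (smul_finsum' r (𝒞.finite_support a F)).symm }
    fun F G => by
      simp only [LinearMap.coe_mk, AddHom.coe_mk, smul_eq_mul, Derivation.leibniz]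
      rw [mul_finsum' _ _ (𝒞.finite_support a G), mul_finsum' _ _ (𝒞.finite_support a F),
        ← finsum_add_distrib]
      · exact finsum_congr fun c => by ring
      · exact (𝒞.finite_support a G).subset fun c hc => right_ne_zero_of_mul hc
      · exact (𝒞.finite_support a F).subset fun c hc => right_ne_zero_of_mul hc

theorem vf_apply (a : Coord → A) (F : A) : 𝒞.vf a F = ∑ᶠ c, a c * 𝒞.pd c F := rfl

theorem vf_eq_sum (a : Coord → A) {F : A} {s : Finset Coord} (hs : ∀ c ∉ s, 𝒞.pd c F = 0) :
    𝒞.vf a F = ∑ c ∈ s, a c * 𝒞.pd c F :=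
  finsum_eq_sum_of_support_subset _ (𝒞.support_subset hs a)

@[simp]
theorem vf_coord (a : Coord → A) (c : Coord) : 𝒞.vf a (𝒞.coord c) = a c := by
  rw [𝒞.vf_eq_sum a (s := {c})]
  · simp [pd_coord]
  · intro d hd
    have : c ≠ d := fun h => hd (by simp [h])
    simp [pd_coord, this]

/-- A derivation obeys the chain rule if it is the vector field given by its values on the
variables. -/
def ChainRule (D : Derivation ℝ A A) : Prop :=
  ∀ F, D F = 𝒞.vf (fun c => D (𝒞.coord c)) F

variable {𝒞}

theorem ChainRule.eq_sum {D : Derivation ℝ A A} (hD : 𝒞.ChainRule D) {F : A} {s : Finset Coord}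
    (hs : ∀ c ∉ s, 𝒞.pd c F = 0) : D F = ∑ c ∈ s, D (𝒞.coord c) * 𝒞.pd c F :=
  (hD F).trans (𝒞.vf_eq_sum _ hs)

theorem ChainRule.eq_mul_of_eq_zero {D : Derivation ℝ A A} (hD : 𝒞.ChainRule D) {F : A} {c : Coord}
    (h : ∀ d ≠ c, D (𝒞.coord d) * 𝒞.pd d F = 0) : D F = D (𝒞.coord c) * 𝒞.pd c F := by
  rw [hD F, vf_apply]
  exact finsum_eq_single _ c h

theorem chainRule_vf (a : Coord → A) : 𝒞.ChainRule (𝒞.vf a) := fun F => by simp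

theorem chainRule_pd (c : Coord) : 𝒞.ChainRule (𝒞.pd c) := fun F => by
  obtain ⟨s, hs⟩ := 𝒞.exists_pd_eq_zero F
  rw [𝒞.vf_eq_sum _ (s := insert c s) (fun d hd => hs d fun h => hd (Finset.mem_insert_of_mem h))]
  simp [pd_coord]

theorem ChainRule.sub {D E : Derivation ℝ A A} (hD : 𝒞.ChainRule D) (hE : 𝒞.ChainRule E) :
    𝒞.ChainRule (D - E) := fun F => by
  obtain ⟨s, hs⟩ := 𝒞.exists_pd_eq_zero F
  rw [𝒞.vf_eq_sum _ hs, Derivation.sub_apply, hD.eq_sum hs, hE.eq_sum hs]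
  simp [sub_mul]

theorem ChainRule.smul {D : Derivation ℝ A A} (hD : 𝒞.ChainRule D) (a : A) :
    𝒞.ChainRule (a • D) := fun F => by
  obtain ⟨s, hs⟩ := 𝒞.exists_pd_eq_zero F
  rw [𝒞.vf_eq_sum _ hs, Derivation.smul_apply, hD.eq_sum hs, smul_eq_mul, Finset.mul_sum]
  simp [mul_assoc]

/-- The second order terms cancel because the partial derivatives commute. -/
theorem ChainRule.lie {D E : Derivation ℝ A A} (hD : 𝒞.ChainRule D) (hE : 𝒞.ChainRule E) :
    𝒞.ChainRule ⁅D, E⁆ := fun F => by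
  obtain ⟨s, hs⟩ := 𝒞.exists_pd_eq_zero F
  have h2 : ∀ d, ∀ c ∉ s, 𝒞.pd c (𝒞.pd d F) = 0 := fun d c hc => by
    rw [𝒞.pd_comm, hs c hc, map_zero]
  rw [𝒞.vf_eq_sum _ hs, Derivation.commutator_apply, hE.eq_sum hs, hD.eq_sum hs, map_sum, map_sum]
  simp only [Derivation.leibniz, smul_eq_mul, Derivation.commutator_apply, sub_mul,
    Finset.sum_add_distrib, Finset.sum_sub_distrib]
  have h3 : ∑ c ∈ s, E (𝒞.coord c) * D (𝒞.pd c F) = ∑ c ∈ s, D (𝒞.coord c) * E (𝒞.pd c F) := by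
    simp only [fun c => hD.eq_sum (h2 c), fun c => hE.eq_sum (h2 c), Finset.mul_sum]
    rw [Finset.sum_comm]
    refine Finset.sum_congr rfl fun c _ => Finset.sum_congr rfl fun d _ => ?_
    rw [𝒞.pd_comm]; ring
  rw [h3, Finset.sum_congr rfl fun c _ => mul_comm (D (E (𝒞.coord c))) _,
    Finset.sum_congr rfl fun c _ => mul_comm (E (D (𝒞.coord c))) _]
  ring

/-- The derivation is a vector field that annihilates the function. -/
structure Annihilates (𝒞 : CoordinateAlgebra A) (D : Derivation ℝ A A) (F : A) : Prop where
  chainRule : 𝒞.ChainRule D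
  apply_eq_zero : D F = 0

theorem Annihilates.sub {D E : Derivation ℝ A A} {F : A} (hD : 𝒞.Annihilates D F)
    (hE : 𝒞.Annihilates E F) : 𝒞.Annihilates (D - E) F :=
  ⟨hD.1.sub hE.1, by rw [Derivation.sub_apply, hD.2, hE.2, sub_zero]⟩

theorem Annihilates.smul {D : Derivation ℝ A A} {F : A} (hD : 𝒞.Annihilates D F) (a : A) :
    𝒞.Annihilates (a • D) F :=
  ⟨hD.1.smul a, by rw [Derivation.smul_apply, hD.2, smul_zero]⟩

theorem Annihilates.lie {D E : Derivation ℝ A A} {F : A} (hD : 𝒞.Annihilates D F)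
    (hE : 𝒞.Annihilates E F) : 𝒞.Annihilates ⁅D, E⁆ F :=
  ⟨hD.1.lie hE.1, by rw [Derivation.commutator_apply, hD.2, hE.2, map_zero, map_zero, sub_zero]⟩

/-- If the only possible nonzero term in `D F = 0` is the one with `∂F/∂c`, and `D c` is a unit,
then `∂F/∂c = 0`. -/
theorem Annihilates.pd_eq_zero {D : Derivation ℝ A A} {F : A} (hD : 𝒞.Annihilates D F) {c : Coord}
    (hc : IsUnit (D (𝒞.coord c))) (h : ∀ d ≠ c, D (𝒞.coord d) = 0 ∨ 𝒞.pd d F = 0) :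
    𝒞.pd c F = 0 := by
  have h1 := hD.1.eq_mul_of_eq_zero fun d hd => by
    rcases h d hd with h | h
    · rw [h, zero_mul]
    · rw [h, mul_zero]
  rw [hD.2] at h1
  exact (hc.mul_right_eq_zero).1 h1.symm

end CoordinateAlgebra

/-! ### The potentials as power series -/

section RealSeries

open PowerSeries

/-- Half of the parameter `λ` of the generating series. -/
noncomputable def halfParam : ℝ⟦X⟧ := C (1 / 2) * X

/-- The series `1 / (1 - λ)`. -/
noncomputable def geomSeries : ℝ⟦X⟧ := PowerSeries.mk fun _ => 1

/-- The series `(λ + λ² / (2 (1 - λ))) / 2`. -/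
noncomputable def serA : ℝ⟦X⟧ := halfParam * (1 - halfParam) * geomSeries

/-- The series `λ² / (4 (1 - λ))`. -/
noncomputable def serB : ℝ⟦X⟧ := halfParam ^ 2 * geomSeries

/-- The series `1 + λ² / (4 (1 - λ))`. -/
noncomputable def serD : ℝ⟦X⟧ := (1 - halfParam) ^ 2 * geomSeries

theorem two_mul_halfParam : 2 * halfParam = X := by
  have : (2 : ℝ⟦X⟧) = C 2 := (map_ofNat C 2).symm
  rw [halfParam, this, ← mul_assoc, ← map_mul]
  norm_num

theorem geomSeries_mul : geomSeries * (1 - 2 * halfParam) = 1 := by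
  rw [two_mul_halfParam]
  exact mk_one_mul_one_sub_eq_one ℝ

theorem serD_eq : serD = 1 + serB := by
  rw [serD, serB]
  linear_combination geomSeries_mul

theorem one_sub_mul_serB : (1 - halfParam) * serB = halfParam * serA := by
  rw [serA, serB]; ring

theorem one_sub_mul_serA : (1 - halfParam) * serA = halfParam * serD := by
  rw [serA, serD]; ring

@[simp]
theorem constantCoeff_halfParam : constantCoeff halfParam = 0 := by simp [halfParam]

@[simp]
theorem constantCoeff_geomSeries : constantCoeff geomSeries = 1 := by
  rw [← coeff_zero_eq_constantCoeff_apply]; simp [geomSeries]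

@[simp]
theorem constantCoeff_serA : constantCoeff serA = 0 := by simp [serA]

@[simp]
theorem constantCoeff_serB : constantCoeff serB = 0 := by simp [serB]

@[simp]
theorem constantCoeff_serD : constantCoeff serD = 1 := by simp [serD]

theorem serA_pow (n : ℕ) :
    serA ^ n = X ^ n * (C (1 / 2) * ((1 - halfParam) * geomSeries)) ^ n := by
  rw [← mul_pow, serA, halfParam]; ring

end RealSeries

namespace CoordinateAlgebra

open PowerSeries

variable {A : Type*} [CommRing A] [Algebra ℝ A] (𝒞 : CoordinateAlgebra A)

/-- The generating series of the potentials `u_n`. -/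
noncomputable def uSeries : A⟦X⟧ := PowerSeries.mk fun n => Nat.casesOn n 1 fun m => 𝒞.coord (.u m)

/-- The generating series of the potentials `v_n`. -/
noncomputable def vSeries : A⟦X⟧ := PowerSeries.mk fun n => Nat.casesOn n 0 fun m => 𝒞.coord (.v m)

/-- The generating series of the potentials `w_n`. -/
noncomputable def wSeries : A⟦X⟧ := PowerSeries.mk fun n => Nat.casesOn n 0 fun m => 𝒞.coord (.w m)

/-- The series `v - x u`, whose constant term is `-x`. -/
noncomputable def vShift : A⟦X⟧ := 𝒞.vSeries - C (𝒞.coord .x) * 𝒞.uSeries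

/-- A real power series, seen as a series with coefficients in the algebra. -/
noncomputable abbrev real (A : Type*) [CommRing A] [Algebra ℝ A] : ℝ⟦X⟧ →+* A⟦X⟧ :=
  PowerSeries.map (algebraMap ℝ A)

/-- The factor of `ū` in the equation that determines it. -/
noncomputable def ubarFactor : A⟦X⟧ :=
  (1 - real A halfParam) * 𝒞.uSeries + real A halfParam * C (𝒞.coord .y) * 𝒞.vShift

/-- The generating series of the functions `ū_n`. -/
noncomputable def ubarSeries : A⟦X⟧ :=
  (1 + real A halfParam * 𝒞.vShift * 𝒞.wSeries) * invOfUnit 𝒞.ubarFactor 1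

/-- The series `w - y ū`, whose constant term is `-y`. -/
noncomputable def wShift : A⟦X⟧ := 𝒞.wSeries - C (𝒞.coord .y) * 𝒞.ubarSeries

@[simp]
theorem coeff_succ_uSeries (n : ℕ) : coeff (n + 1) 𝒞.uSeries = 𝒞.coord (.u n) := coeff_mk _ _

@[simp]
theorem coeff_succ_vSeries (n : ℕ) : coeff (n + 1) 𝒞.vSeries = 𝒞.coord (.v n) := coeff_mk _ _

@[simp]
theorem coeff_succ_wSeries (n : ℕ) : coeff (n + 1) 𝒞.wSeries = 𝒞.coord (.w n) := coeff_mk _ _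

@[simp]
theorem constantCoeff_uSeries : constantCoeff 𝒞.uSeries = 1 := by
  rw [← coeff_zero_eq_constantCoeff_apply]; exact coeff_mk 0 _

@[simp]
theorem constantCoeff_vSeries : constantCoeff 𝒞.vSeries = 0 := by
  rw [← coeff_zero_eq_constantCoeff_apply]; exact coeff_mk 0 _

@[simp]
theorem constantCoeff_wSeries : constantCoeff 𝒞.wSeries = 0 := by
  rw [← coeff_zero_eq_constantCoeff_apply]; exact coeff_mk 0 _

@[simp]
theorem constantCoeff_vShift : constantCoeff 𝒞.vShift = -𝒞.coord .x := by simp [vShift]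

@[simp]
theorem constantCoeff_real (p : ℝ⟦X⟧) :
    constantCoeff (real A p) = algebraMap ℝ A (constantCoeff p) := by
  rw [← coeff_zero_eq_constantCoeff_apply, ← coeff_zero_eq_constantCoeff_apply, coeff_map]

theorem constantCoeff_ubarFactor : constantCoeff 𝒞.ubarFactor = 1 := by
  simp [ubarFactor]

theorem isUnit_ubarFactor : IsUnit 𝒞.ubarFactor := by
  rw [isUnit_iff_constantCoeff, constantCoeff_ubarFactor]
  exact isUnit_one

theorem ubarFactor_mul_ubarSeries :
    𝒞.ubarFactor * 𝒞.ubarSeries = 1 + real A halfParam * 𝒞.vShift * 𝒞.wSeries := by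
  rw [ubarSeries, mul_left_comm, mul_invOfUnit _ _ (by rw [constantCoeff_ubarFactor]; simp),
    mul_one]

@[simp]
theorem constantCoeff_ubarSeries : constantCoeff 𝒞.ubarSeries = 1 := by
  simp [ubarSeries]

@[simp]
theorem constantCoeff_wShift : constantCoeff 𝒞.wShift = -𝒞.coord .y := by simp [wShift]

/-- The recursion for `ū` says that a matrix with entries `u`, `v - x u`, `w - y ū`, `ū`, suitably
weighted, has determinant `1`. -/
theorem determinant_eq_one :
    (1 - real A halfParam) * 𝒞.uSeries * 𝒞.ubarSeries
      - real A halfParam * 𝒞.vShift * 𝒞.wShift = 1 := by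
  have h := 𝒞.ubarFactor_mul_ubarSeries
  rw [ubarFactor] at h
  rw [wShift]
  linear_combination h

/-- The derivation acts on the columns `(u, v - x u)` and `(w - y ū, ū)` by the traceless matrices
with entries `α, β, γ, -α` and `α, β₂, γ₂, -α`. -/
structure ActsBy (D : Derivation ℝ A A) (α β γ β₂ γ₂ : A⟦X⟧) : Prop where
  u : seriesDerivation D 𝒞.uSeries = α * 𝒞.uSeries + β * 𝒞.vShift
  v : seriesDerivation D 𝒞.vShift = γ * 𝒞.uSeries - α * 𝒞.vShift
  w : seriesDerivation D 𝒞.wShift = α * 𝒞.wShift + β₂ * 𝒞.ubarSeries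
  ubar : seriesDerivation D 𝒞.ubarSeries = γ₂ * 𝒞.wShift - α * 𝒞.ubarSeries

variable {𝒞}

/-- The action on `ū` is forced by the determinant relation. -/
theorem actsBy_of_potentials {D : Derivation ℝ A A} {α β γ β₂ γ₂ : A⟦X⟧}
    (hu : seriesDerivation D 𝒞.uSeries = α * 𝒞.uSeries + β * 𝒞.vShift)
    (hv : seriesDerivation D 𝒞.vSeries = γ * 𝒞.uSeries - α * 𝒞.vShift
      + C (D (𝒞.coord .x)) * 𝒞.uSeries
      + C (𝒞.coord .x) * (α * 𝒞.uSeries + β * 𝒞.vShift))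
    (hw : seriesDerivation D 𝒞.wSeries = α * 𝒞.wShift + β₂ * 𝒞.ubarSeries
      + C (D (𝒞.coord .y)) * 𝒞.ubarSeries
      + C (𝒞.coord .y) * (γ₂ * 𝒞.wShift - α * 𝒞.ubarSeries))
    (h₁ : (1 - real A halfParam) * γ₂ = real A halfParam * γ)
    (h₂ : (1 - real A halfParam) * β = real A halfParam * β₂) :
    𝒞.ActsBy D α β γ β₂ γ₂ := by
  have hv' : seriesDerivation D 𝒞.vShift = γ * 𝒞.uSeries - α * 𝒞.vShift := by
    rw [vShift, map_sub, seriesDerivation_mul, seriesDerivation_C, hv, hu, vShift]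
    ring
  have hubar : seriesDerivation D 𝒞.ubarSeries = γ₂ * 𝒞.wShift - α * 𝒞.ubarSeries := by
    have h := 𝒞.determinant_eq_one
    rw [wShift] at h
    replace h := congrArg (seriesDerivation D) h
    simp only [seriesDerivation_mul, map_sub, seriesDerivation_C, seriesDerivation_map,
      Derivation.map_one_eq_zero, hu, hv', hw] at h
    refine 𝒞.isUnit_ubarFactor.mul_left_cancel ?_
    rw [ubarFactor]
    simp only [wShift] at h ⊢
    linear_combination h - (𝒞.uSeries * (𝒞.wSeries - C (𝒞.coord .y) * 𝒞.ubarSeries)) * h₁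
      - 𝒞.ubarSeries * 𝒞.vShift * h₂
  refine ⟨hu, hv', ?_, hubar⟩
  rw [wShift, map_sub, seriesDerivation_mul, seriesDerivation_C, hubar, hw, wShift]
  ring

theorem ActsBy.sub {D E : Derivation ℝ A A} {α β γ β₂ γ₂ α' β' γ' β₂' γ₂' : A⟦X⟧}
    (hD : 𝒞.ActsBy D α β γ β₂ γ₂) (hE : 𝒞.ActsBy E α' β' γ' β₂' γ₂') :
    𝒞.ActsBy (D - E) (α - α') (β - β') (γ - γ') (β₂ - β₂') (γ₂ - γ₂') where
  u := by rw [seriesDerivation_sub, hD.u, hE.u]; ring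
  v := by rw [seriesDerivation_sub, hD.v, hE.v]; ring
  w := by rw [seriesDerivation_sub, hD.w, hE.w]; ring
  ubar := by rw [seriesDerivation_sub, hD.ubar, hE.ubar]; ring

theorem ActsBy.smul {D : Derivation ℝ A A} {α β γ β₂ γ₂ : A⟦X⟧}
    (hD : 𝒞.ActsBy D α β γ β₂ γ₂) (a : A) :
    𝒞.ActsBy (a • D) (C a * α) (C a * β) (C a * γ) (C a * β₂) (C a * γ₂) where
  u := by rw [seriesDerivation_smul, hD.u]; ring
  v := by rw [seriesDerivation_smul, hD.v]; ring
  w := by rw [seriesDerivation_smul, hD.w]; ring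
  ubar := by rw [seriesDerivation_smul, hD.ubar]; ring

theorem ActsBy.lie {D E : Derivation ℝ A A} {α β γ β₂ γ₂ α' β' γ' β₂' γ₂' : A⟦X⟧}
    (hD : 𝒞.ActsBy D α β γ β₂ γ₂) (hE : 𝒞.ActsBy E α' β' γ' β₂' γ₂')
    (h : β₂' * γ₂ - β₂ * γ₂' = β' * γ - β * γ') :
    𝒞.ActsBy ⁅D, E⁆
      (seriesDerivation D α' - seriesDerivation E α + (β' * γ - β * γ'))
      (seriesDerivation D β' - seriesDerivation E β + 2 * (α' * β - α * β'))
      (seriesDerivation D γ' - seriesDerivation E γ + 2 * (α * γ' - α' * γ))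
      (seriesDerivation D β₂' - seriesDerivation E β₂ + 2 * (α' * β₂ - α * β₂'))
      (seriesDerivation D γ₂' - seriesDerivation E γ₂ + 2 * (α * γ₂' - α' * γ₂)) where
  u := by
    rw [seriesDerivation_lie, hD.u, hE.u]
    simp only [map_add, seriesDerivation_mul, hD.u, hD.v, hE.u, hE.v]
    ring
  v := by
    rw [seriesDerivation_lie, hD.v, hE.v]
    simp only [map_sub, seriesDerivation_mul, hD.u, hD.v, hE.u, hE.v]
    ring
  w := by
    rw [seriesDerivation_lie, hD.w, hE.w]
    simp only [map_add, seriesDerivation_mul, hD.w, hD.ubar, hE.w, hE.ubar]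
    linear_combination 𝒞.wShift * h
  ubar := by
    rw [seriesDerivation_lie, hD.ubar, hE.ubar]
    simp only [map_sub, seriesDerivation_mul, hD.w, hD.ubar, hE.w, hE.ubar]
    linear_combination -𝒞.ubarSeries * h

theorem actsBy_zero_of_potentials {D : Derivation ℝ A A}
    (hx : D (𝒞.coord .x) = 0) (hy : D (𝒞.coord .y) = 0) (hu : ∀ n, D (𝒞.coord (.u n)) = 0)
    (hv : ∀ n, D (𝒞.coord (.v n)) = 0) (hw : ∀ n, D (𝒞.coord (.w n)) = 0) :
    𝒞.ActsBy D 0 0 0 0 0 := by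
  refine actsBy_of_potentials ?_ ?_ ?_ (by simp) (by simp)
  all_goals
    ext n
    rcases n with _ | n <;> simp [hx, hy, hu, hv, hw]

theorem apply_zinv {D : Derivation ℝ A A} (h : D (𝒞.coord (.z 0)) = 0) : D 𝒞.zinv = 0 := by
  have := congrArg D 𝒞.coord_mul_zinv
  rw [Derivation.leibniz, h, smul_zero, add_zero, Derivation.map_one_eq_zero, smul_eq_mul] at this
  linear_combination 𝒞.zinv * this - D 𝒞.zinv * 𝒞.coord_mul_zinv

variable (𝒞)

/-! ### The total derivatives -/

/-- The components of the vector field that maps `x`, `y` to `ξ`, `η` and the jet coordinates to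
`ζ`, `ζy`, and acts on the potentials by the given matrices. -/
noncomputable def coverCoeff (ξ η : A) (ζ ζy : ℕ → A) (α β γ β₂ γ₂ : A⟦X⟧) : Coord → A
  | .x => ξ
  | .y => η
  | .z i => ζ i
  | .zy i => ζy i
  | .u n => coeff (n + 1) (α * 𝒞.uSeries + β * 𝒞.vShift)
  | .v n => coeff (n + 1) (γ * 𝒞.uSeries - α * 𝒞.vShift + C ξ * 𝒞.uSeries
      + C (𝒞.coord .x) * (α * 𝒞.uSeries + β * 𝒞.vShift))
  | .w n => coeff (n + 1) (α * 𝒞.wShift + β₂ * 𝒞.ubarSeries + C η * 𝒞.ubarSeries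
      + C (𝒞.coord .y) * (γ₂ * 𝒞.wShift - α * 𝒞.ubarSeries))

theorem actsBy_vf_coverCoeff {ξ η : A} {ζ ζy : ℕ → A} {α β γ β₂ γ₂ : A⟦X⟧}
    (hα : constantCoeff α = 0) (hβ : constantCoeff β = 0) (hγ : constantCoeff γ = -ξ)
    (hβ₂ : constantCoeff β₂ = -η) (hγ₂ : constantCoeff γ₂ = 0)
    (h₁ : (1 - real A halfParam) * γ₂ = real A halfParam * γ)
    (h₂ : (1 - real A halfParam) * β = real A halfParam * β₂) :
    𝒞.ActsBy (𝒞.vf (𝒞.coverCoeff ξ η ζ ζy α β γ β₂ γ₂)) α β γ β₂ γ₂ := by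
  refine actsBy_of_potentials ?_ ?_ ?_ h₁ h₂
  all_goals
    ext n
    rcases n with _ | n
    · simp [hα, hβ, hγ, hβ₂, hγ₂, coverCoeff]
    · rw [coeff_seriesDerivation]
      simp only [coeff_succ_uSeries, coeff_succ_vSeries, coeff_succ_wSeries, vf_coord, coverCoeff]

/-- The diagonal entry in the matrices of the total derivative in the direction `x`. -/
noncomputable def xDiag : A⟦X⟧ :=
  -(C (𝒞.coord (.zy 0)) * real A (C (1 / 2) * serA)
    + C (𝒞.coord (.z 1)) * (C 𝒞.zinv * real A (C (1 / 2) * serB)))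

/-- The diagonal entry in the matrices of the total derivative in the direction `y`. -/
noncomputable def yDiag : A⟦X⟧ :=
  -(C (𝒞.coord (.z 1) * 𝒞.zinv ^ 2) * real A (C (1 / 2) * serA)
    + C (𝒞.coord (.zy 0)) * (C 𝒞.zinv * real A (C (1 / 2) * serB)))

/-- The total derivative of the covering in the direction `x`. -/
noncomputable def dx : Derivation ℝ A A :=
  𝒞.vf (𝒞.coverCoeff 1 0 (fun i => 𝒞.coord (.z (i + 1))) (fun i => 𝒞.coord (.zy (i + 1)))
    𝒞.xDiag (-(C (𝒞.coord (.z 0)) * real A serB)) (-real A serD)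
    (-(C (𝒞.coord (.z 0)) * real A serA)) (-real A serA))

/-- The total derivative of the covering in the direction `y`, without its components along the
jet coordinates of the form `z_{x…xy}`. -/
noncomputable def dy : Derivation ℝ A A :=
  𝒞.vf (𝒞.coverCoeff 0 1 (fun i => 𝒞.coord (.zy i)) 0
    𝒞.yDiag (-real A serA) (-(C 𝒞.zinv * real A serA))
    (-real A serD) (-(C 𝒞.zinv * real A serB)))

theorem real_one_sub_mul_serB : (1 - real A halfParam) * real A serB =
    real A halfParam * real A serA := by
  rw [← map_one (real A), ← map_sub, ← map_mul, ← map_mul, one_sub_mul_serB]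

theorem real_one_sub_mul_serA : (1 - real A halfParam) * real A serA =
    real A halfParam * real A serD := by
  rw [← map_one (real A), ← map_sub, ← map_mul, ← map_mul, one_sub_mul_serA]

theorem actsBy_dx : 𝒞.ActsBy 𝒞.dx 𝒞.xDiag (-(C (𝒞.coord (.z 0)) * real A serB)) (-real A serD)
    (-(C (𝒞.coord (.z 0)) * real A serA)) (-real A serA) := by
  refine 𝒞.actsBy_vf_coverCoeff ?_ ?_ ?_ ?_ ?_ ?_ ?_
  · simp [xDiag]
  · simp
  · simp
  · simp
  · simp
  · linear_combination -real_one_sub_mul_serA (A := A)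
  · linear_combination -C (𝒞.coord (.z 0)) * real_one_sub_mul_serB (A := A)

theorem actsBy_dy : 𝒞.ActsBy 𝒞.dy 𝒞.yDiag (-real A serA) (-(C 𝒞.zinv * real A serA))
    (-real A serD) (-(C 𝒞.zinv * real A serB)) := by
  refine 𝒞.actsBy_vf_coverCoeff ?_ ?_ ?_ ?_ ?_ ?_ ?_
  · simp [yDiag]
  · simp
  · simp
  · simp
  · simp
  · linear_combination -C 𝒞.zinv * real_one_sub_mul_serB (A := A)
  · linear_combination -real_one_sub_mul_serA (A := A)

variable {𝒞}

@[simp] theorem dx_x : 𝒞.dx (𝒞.coord .x) = 1 := vf_coord _ _ _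
@[simp] theorem dx_y : 𝒞.dx (𝒞.coord .y) = 0 := vf_coord _ _ _
@[simp] theorem dx_z (i : ℕ) : 𝒞.dx (𝒞.coord (.z i)) = 𝒞.coord (.z (i + 1)) := vf_coord _ _ _
@[simp] theorem dx_zy (i : ℕ) : 𝒞.dx (𝒞.coord (.zy i)) = 𝒞.coord (.zy (i + 1)) := vf_coord _ _ _
@[simp] theorem dy_x : 𝒞.dy (𝒞.coord .x) = 0 := vf_coord _ _ _
@[simp] theorem dy_y : 𝒞.dy (𝒞.coord .y) = 1 := vf_coord _ _ _
@[simp] theorem dy_z (i : ℕ) : 𝒞.dy (𝒞.coord (.z i)) = 𝒞.coord (.zy i) := vf_coord _ _ _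

theorem chainRule_dx : 𝒞.ChainRule 𝒞.dx := chainRule_vf _
theorem chainRule_dy : 𝒞.ChainRule 𝒞.dy := chainRule_vf _

/-! ### Elimination of the jet coordinates -/

theorem actsBy_pd_z (i : ℕ) : 𝒞.ActsBy (𝒞.pd (.z i)) 0 0 0 0 0 := by
  apply actsBy_zero_of_potentials <;> simp [pd_coord]

theorem actsBy_pd_zy (i : ℕ) : 𝒞.ActsBy (𝒞.pd (.zy i)) 0 0 0 0 0 := by
  apply actsBy_zero_of_potentials <;> simp [pd_coord]

/-- The low order values of a derivation on the variables can be read off from its action on the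
shifted series, because `-x` and `-y` are their constant terms. -/
theorem apply_of_X_pow_dvd {D : Derivation ℝ A A} {n : ℕ}
    (hu : X ^ (n + 1) ∣ seriesDerivation D 𝒞.uSeries)
    (hv : X ^ (n + 1) ∣ seriesDerivation D 𝒞.vShift)
    (hw : X ^ (n + 1) ∣ seriesDerivation D 𝒞.wShift)
    (hb : X ^ (n + 1) ∣ seriesDerivation D 𝒞.ubarSeries) :
    D (𝒞.coord .x) = 0 ∧ D (𝒞.coord .y) = 0 ∧
    (∀ m < n, D (𝒞.coord (.u m)) = 0 ∧ D (𝒞.coord (.v m)) = 0 ∧ D (𝒞.coord (.w m)) = 0) ∧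
    D (𝒞.coord (.u n)) = coeff (n + 1) (seriesDerivation D 𝒞.uSeries) ∧
    D (𝒞.coord (.v n)) = coeff (n + 1) (seriesDerivation D 𝒞.vShift)
      + 𝒞.coord .x * coeff (n + 1) (seriesDerivation D 𝒞.uSeries) ∧
    D (𝒞.coord (.w n)) = coeff (n + 1) (seriesDerivation D 𝒞.wShift)
      + 𝒞.coord .y * coeff (n + 1) (seriesDerivation D 𝒞.ubarSeries) := by
  rw [X_pow_dvd_iff] at hu hv hw hb
  have hx : D (𝒞.coord .x) = 0 := by
    have := hv 0 (by omega)
    rw [coeff_seriesDerivation, coeff_zero_eq_constantCoeff_apply, constantCoeff_vShift,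
      map_neg, neg_eq_zero] at this
    exact this
  have hy : D (𝒞.coord .y) = 0 := by
    have := hw 0 (by omega)
    rw [coeff_seriesDerivation, coeff_zero_eq_constantCoeff_apply, constantCoeff_wShift,
      map_neg, neg_eq_zero] at this
    exact this
  have eu : ∀ m, D (𝒞.coord (.u m)) = coeff (m + 1) (seriesDerivation D 𝒞.uSeries) := by simp
  have ev : ∀ m, D (𝒞.coord (.v m)) = coeff (m + 1) (seriesDerivation D 𝒞.vShift)
      + 𝒞.coord .x * coeff (m + 1) (seriesDerivation D 𝒞.uSeries) := fun m => by
    simp [vShift, hx]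
  have ew : ∀ m, D (𝒞.coord (.w m)) = coeff (m + 1) (seriesDerivation D 𝒞.wShift)
      + 𝒞.coord .y * coeff (m + 1) (seriesDerivation D 𝒞.ubarSeries) := fun m => by
    simp [wShift, hy]
  refine ⟨hx, hy, fun m hm => ⟨?_, ?_, ?_⟩, eu n, ev n, ew n⟩
  · rw [eu, hu _ (by omega)]
  · rw [ev, hu _ (by omega), hv _ (by omega), mul_zero, add_zero]
  · rw [ew, hb _ (by omega), hw _ (by omega), mul_zero, add_zero]

theorem ActsBy.apply_potentials {D : Derivation ℝ A A} (hD : 𝒞.ActsBy D 0 0 0 0 0) :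
    D (𝒞.coord .x) = 0 ∧ D (𝒞.coord .y) = 0 ∧ ∀ n, D (𝒞.coord (.u n)) = 0 ∧
      D (𝒞.coord (.v n)) = 0 ∧ D (𝒞.coord (.w n)) = 0 := by
  have h := fun n => apply_of_X_pow_dvd (𝒞 := 𝒞) (D := D) (n := n)
    (by simp [hD.u]) (by simp [hD.v]) (by simp [hD.w]) (by simp [hD.ubar])
  exact ⟨(h 0).1, (h 0).2.1, fun n => (h (n + 1)).2.2.1 n (by omega)⟩

theorem ActsBy.lie_of_zero {D E : Derivation ℝ A A} {α β γ β₂ γ₂ : A⟦X⟧}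
    (hD : 𝒞.ActsBy D 0 0 0 0 0) (hE : 𝒞.ActsBy E α β γ β₂ γ₂) :
    𝒞.ActsBy ⁅D, E⁆ (seriesDerivation D α) (seriesDerivation D β) (seriesDerivation D γ)
      (seriesDerivation D β₂) (seriesDerivation D γ₂) := by
  simpa using hD.lie hE (by simp)

theorem pd_zinv {c : Coord} (h : c ≠ .z 0) : 𝒞.pd c 𝒞.zinv = 0 :=
  apply_zinv (by rw [pd_coord, if_neg h.symm])

theorem exists_forall_pd_eq_zero (𝒞 : CoordinateAlgebra A) (F : A) (k : ℕ → Coord)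
    (hk : Function.Injective k) : ∃ N, ∀ n, N ≤ n → 𝒞.pd (k n) F = 0 := by
  obtain ⟨s, hs⟩ := 𝒞.exists_pd_eq_zero F
  have hfin : {n | k n ∈ s}.Finite := s.finite_toSet.preimage hk.injOn
  obtain ⟨N, hN⟩ := hfin.bddAbove
  refine ⟨N + 1, fun n hn => hs _ fun h => ?_⟩
  have : n ≤ N := hN h
  omega

/-- The bracket of `∂/∂z_{i+2}` with the total derivative is `∂/∂z_{i+1}`, so that a function
annihilated by the total derivative does not depend on any derivative of `z` in the direction
`x`. -/
theorem pd_z_succ_eq_zero {F : A} (hx : 𝒞.dx F = 0) (i : ℕ) : 𝒞.pd (.z (i + 1)) F = 0 := by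
  obtain ⟨N, hN⟩ := 𝒞.exists_forall_pd_eq_zero F (fun n => .z (n + 1)) fun m n h => by simpa using h
  by_cases hi : N ≤ i
  · exact hN i hi
  refine Nat.decreasingInduction (motive := fun i _ => 𝒞.pd (.z (i + 1)) F = 0)
    (fun i _ ih => ?_) (hN N le_rfl) (not_le.1 hi).le
  have hD : 𝒞.Annihilates ⁅𝒞.pd (.z (i + 2)), 𝒞.dx⁆ F :=
    .lie ⟨chainRule_pd _, ih⟩ ⟨chainRule_dx, hx⟩
  have hA : 𝒞.ActsBy ⁅𝒞.pd (.z (i + 2)), 𝒞.dx⁆ 0 0 0 0 0 := by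
    simpa [xDiag, seriesDerivation_mul, pd_coord, pd_zinv] using
      (actsBy_pd_z (i + 2)).lie_of_zero 𝒞.actsBy_dx
  have hP := hA.apply_potentials
  refine hD.pd_eq_zero ?_ fun d hd => Or.inl ?_
  · simp [Derivation.commutator_apply, pd_coord]
  · cases d <;> simp_all [Derivation.commutator_apply, pd_coord, apply_ite]

theorem pd_zy_eq_zero {F : A} (hx : 𝒞.dx F = 0) (i : ℕ) : 𝒞.pd (.zy i) F = 0 := by
  obtain ⟨N, hN⟩ := 𝒞.exists_forall_pd_eq_zero F (fun n => .zy n) fun m n h => by simpa using h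
  by_cases hi : N ≤ i
  · exact hN i hi
  refine Nat.decreasingInduction (motive := fun i _ => 𝒞.pd (.zy i) F = 0)
    (fun i _ ih => ?_) (hN N le_rfl) (not_le.1 hi).le
  have hD : 𝒞.Annihilates ⁅𝒞.pd (.zy (i + 1)), 𝒞.dx⁆ F :=
    .lie ⟨chainRule_pd _, ih⟩ ⟨chainRule_dx, hx⟩
  have hA : 𝒞.ActsBy ⁅𝒞.pd (.zy (i + 1)), 𝒞.dx⁆ 0 0 0 0 0 := by
    simpa [xDiag, seriesDerivation_mul, pd_coord, pd_zinv] using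
      (actsBy_pd_zy (i + 1)).lie_of_zero 𝒞.actsBy_dx
  have hP := hA.apply_potentials
  refine hD.pd_eq_zero ?_ fun d hd => Or.inl ?_
  · simp [Derivation.commutator_apply, pd_coord]
  · cases d <;> simp_all [Derivation.commutator_apply, pd_coord, apply_ite]

/-! ### The Lie algebra generated by the total derivatives -/

/-- The derivation preserves `z` and acts by off-diagonal matrices that depend on the base point
through `z` only. -/
structure ActsOffDiagonally (𝒞 : CoordinateAlgebra A) (D : Derivation ℝ A A)
    (p q p₂ q₂ : ℝ⟦X⟧) : Prop where
  z : D (𝒞.coord (.z 0)) = 0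
  actsBy : 𝒞.ActsBy D 0 (C (𝒞.coord (.z 0)) * real A p) (real A q)
    (C (𝒞.coord (.z 0)) * real A p₂) (real A q₂)

/-- The coefficient of `z_y` in the total derivative in the direction `x` acts diagonally. -/
theorem exists_annihilates_diagonal {F : A} (hx : 𝒞.dx F = 0) :
    ∃ D, 𝒞.Annihilates D F ∧ D (𝒞.coord (.z 0)) = 0 ∧
      𝒞.ActsBy D (-real A (C (1 / 2) * serA)) 0 0 0 0 := by
  refine ⟨⁅𝒞.pd (.zy 0), 𝒞.dx⁆, .lie ⟨chainRule_pd _, pd_zy_eq_zero hx 0⟩ ⟨chainRule_dx, hx⟩,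
    ?_, ?_⟩
  · simp [Derivation.commutator_apply, pd_coord]
  · have h := (actsBy_pd_zy 0).lie_of_zero 𝒞.actsBy_dx
    have e : seriesDerivation (𝒞.pd (.zy 0)) 𝒞.xDiag = -real A (C (1 / 2) * serA) := by
      simp [-map_mul, xDiag, pd_coord, pd_zinv]
    rw [e] at h
    simpa [-map_mul, seriesDerivation_mul, pd_coord] using h

/-- The coefficient of `z_x` in the total derivative in the direction `x`. -/
theorem exists_annihilates_z {F : A} (hx : 𝒞.dx F = 0) :
    ∃ D, 𝒞.Annihilates D F ∧ D (𝒞.coord (.z 0)) = 1 ∧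
      𝒞.ActsBy D (-(C 𝒞.zinv * real A (C (1 / 2) * serB))) 0 0 0 0 := by
  refine ⟨⁅𝒞.pd (.z 1), 𝒞.dx⁆, .lie ⟨chainRule_pd _, pd_z_succ_eq_zero hx 0⟩ ⟨chainRule_dx, hx⟩,
    ?_, ?_⟩
  · simp [Derivation.commutator_apply, pd_coord]
  · have h := (actsBy_pd_z 1).lie_of_zero 𝒞.actsBy_dx
    have e : seriesDerivation (𝒞.pd (.z 1)) 𝒞.xDiag =
        -(C 𝒞.zinv * real A (C (1 / 2) * serB)) := by
      simp [-map_mul, xDiag, pd_coord, pd_zinv]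
    rw [e] at h
    simpa [-map_mul, seriesDerivation_mul, pd_coord] using h

theorem ActsBy.congr {D : Derivation ℝ A A} {α β γ β₂ γ₂ α' β' γ' β₂' γ₂' : A⟦X⟧}
    (h : 𝒞.ActsBy D α β γ β₂ γ₂) (hα : α = α') (hβ : β = β') (hγ : γ = γ') (hβ₂ : β₂ = β₂')
    (hγ₂ : γ₂ = γ₂') : 𝒞.ActsBy D α' β' γ' β₂' γ₂' := by
  subst hα hβ hγ hβ₂ hγ₂; exact h

/-- The remaining part of the total derivative in the direction `x`, up to sign. -/
theorem exists_annihilates_lower {F : A} (hx : 𝒞.dx F = 0) :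
    ∃ D, 𝒞.Annihilates D F ∧ 𝒞.ActsOffDiagonally D serB serD serA serA := by
  obtain ⟨D₁, h₁, hz₁, hA₁⟩ := exists_annihilates_diagonal hx
  obtain ⟨D₂, h₂, hz₂, hA₂⟩ := exists_annihilates_z hx
  refine ⟨(-1 : A) • ((𝒞.dx - 𝒞.coord (.zy 0) • D₁) - 𝒞.coord (.z 1) • D₂),
    (((Annihilates.mk chainRule_dx hx).sub (h₁.smul _)).sub (h₂.smul _)).smul _, ?_, ?_⟩
  · simp [hz₁, hz₂]
  · refine (((𝒞.actsBy_dx.sub (hA₁.smul (𝒞.coord (.zy 0)))).sub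
      (hA₂.smul (𝒞.coord (.z 1)))).smul (-1)).congr ?_ ?_ ?_ ?_ ?_ <;>
    simp only [xDiag, map_neg, map_one] <;> ring

/-- The remaining part of the total derivative in the direction `y`, up to sign and multiplied by
`z`. -/
theorem exists_annihilates_upper {F : A} (hx : 𝒞.dx F = 0) (hy : 𝒞.dy F = 0) :
    ∃ D, 𝒞.Annihilates D F ∧ 𝒞.ActsOffDiagonally D serA serA serD serB := by
  obtain ⟨D₁, h₁, hz₁, hA₁⟩ := exists_annihilates_diagonal hx
  obtain ⟨D₂, h₂, hz₂, hA₂⟩ := exists_annihilates_z hx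
  have hz : C (𝒞.coord (.z 0)) * C 𝒞.zinv = (1 : A⟦X⟧) := by
    rw [← map_mul, 𝒞.coord_mul_zinv, map_one]
  refine ⟨(-𝒞.coord (.z 0)) • ((𝒞.dy - (𝒞.coord (.z 1) * 𝒞.zinv ^ 2) • D₁)
      - 𝒞.coord (.zy 0) • D₂),
    (((Annihilates.mk chainRule_dy hy).sub (h₁.smul _)).sub (h₂.smul _)).smul _, ?_, ?_⟩
  · simp [hz₁, hz₂]
  · refine (((𝒞.actsBy_dy.sub (hA₁.smul (𝒞.coord (.z 1) * 𝒞.zinv ^ 2))).sub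
      (hA₂.smul (𝒞.coord (.zy 0)))).smul (-𝒞.coord (.z 0))).congr ?_ ?_ ?_ ?_ ?_
    · simp only [yDiag, map_neg]; ring
    · simp only [map_neg]; ring
    · simp only [map_neg]; linear_combination real A serA * hz
    · simp only [map_neg]; ring
    · simp only [map_neg]; linear_combination real A serB * hz

theorem two_mul_real_half (p : ℝ⟦X⟧) : 2 * real A (C (1 / 2) * p) = real A p := by
  rw [← map_ofNat (real A) 2, ← map_mul, ← mul_assoc, ← map_ofNat (C (R := ℝ)) 2, ← map_mul]
  norm_num

/-- Bracketing with the diagonal field multiplies an off-diagonal matrix by a series and changes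
the sign of its lower entry. -/
theorem ActsOffDiagonally.lie_diagonal {D E : Derivation ℝ A A} {p q p₂ q₂ : ℝ⟦X⟧}
    (hz : D (𝒞.coord (.z 0)) = 0) (hD : 𝒞.ActsBy D (-real A (C (1 / 2) * serA)) 0 0 0 0)
    (hE : 𝒞.ActsOffDiagonally E p q p₂ q₂) :
    𝒞.ActsOffDiagonally ⁅D, E⁆ (serA * p) (-(serA * q)) (serA * p₂) (-(serA * q₂)) := by
  refine ⟨by rw [Derivation.commutator_apply, hz, hE.z, map_zero, map_zero, sub_zero], ?_⟩
  have h2 := two_mul_real_half (A := A) serA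
  refine (hD.lie hE.actsBy (by ring)).congr ?_ ?_ ?_ ?_ ?_ <;>
    simp only [seriesDerivation_mul, seriesDerivation_C, seriesDerivation_map, hz, map_zero,
      map_neg]
  · ring
  · rw [map_mul _ serA p]; linear_combination C (𝒞.coord (.z 0)) * real A p * h2
  · rw [map_mul _ serA q]; linear_combination -real A q * h2
  · rw [map_mul _ serA p₂]; linear_combination C (𝒞.coord (.z 0)) * real A p₂ * h2
  · rw [map_mul _ serA q₂]; linear_combination -real A q₂ * h2

theorem exists_annihilates_pow {F : A} (hx : 𝒞.dx F = 0) {p q p₂ q₂ : ℝ⟦X⟧}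
    (h : ∃ D, 𝒞.Annihilates D F ∧ 𝒞.ActsOffDiagonally D p q p₂ q₂) (n : ℕ) :
    ∃ D, 𝒞.Annihilates D F ∧ 𝒞.ActsOffDiagonally D (serA ^ n * p) (serA ^ n * ((-1) ^ n * q))
      (serA ^ n * p₂) (serA ^ n * ((-1) ^ n * q₂)) := by
  induction n with
  | zero => simpa using h
  | succ n ih =>
    obtain ⟨D, hD, hz, hA⟩ := exists_annihilates_diagonal hx
    obtain ⟨E, hE, hB⟩ := ih
    refine ⟨⁅D, E⁆, hD.lie hE, ?_⟩
    have := hB.lie_diagonal hz hA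
    convert this using 1 <;> ring

/-- Brackets of off-diagonal fields act diagonally. -/
theorem exists_annihilates_diagonal_pow {F : A} (hx : 𝒞.dx F = 0) (hy : 𝒞.dy F = 0) (n : ℕ) :
    ∃ D, 𝒞.Annihilates D F ∧ D (𝒞.coord (.z 0)) = 0 ∧
      𝒞.ActsBy D (C (𝒞.coord (.z 0)) * real A (serA ^ (n + 1) * (serD - (-1) ^ n * serB)))
        0 0 0 0 := by
  obtain ⟨D, hD, hA⟩ := exists_annihilates_lower hx
  obtain ⟨E, hE, hB⟩ := exists_annihilates_pow hx (exists_annihilates_upper hx hy) n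
  refine ⟨⁅D, E⁆, hD.lie hE, ?_, ?_⟩
  · rw [Derivation.commutator_apply, hA.z, hB.z, map_zero, map_zero, sub_zero]
  · refine (hA.actsBy.lie hB.actsBy ?_).congr ?_ ?_ ?_ ?_ ?_
    · simp only [map_neg, map_mul, map_pow, map_one]; ring
    all_goals simp only [seriesDerivation_mul, seriesDerivation_C, seriesDerivation_map, hA.z, hB.z,
      map_zero]
    · simp only [map_neg, map_mul, map_pow, map_sub, map_one]; ring
    all_goals ring

/-! ### Elimination of the potentials -/

theorem real_serA_pow_mul (n : ℕ) (r : ℝ⟦X⟧) (s : A⟦X⟧) :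
    real A (serA ^ n * r) * s =
      X ^ n * (real A ((C (1 / 2) * ((1 - halfParam) * geomSeries)) ^ n * r) * s) := by
  rw [serA_pow, mul_assoc (X ^ n), map_mul _ (X ^ n), map_pow, map_X, mul_assoc]

theorem X_pow_dvd_real_serA_pow_mul (n : ℕ) (r : ℝ⟦X⟧) (s : A⟦X⟧) :
    X ^ n ∣ real A (serA ^ n * r) * s :=
  ⟨_, real_serA_pow_mul n r s⟩

theorem coeff_real_serA_pow_mul (n : ℕ) (r : ℝ⟦X⟧) (s : A⟦X⟧) :
    coeff n (real A (serA ^ n * r) * s) =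
      algebraMap ℝ A ((1 / 2) ^ n * constantCoeff r) * constantCoeff s := by
  have h := coeff_X_pow_mul
    (real A ((C (1 / 2) * ((1 - halfParam) * geomSeries)) ^ n * r) * s) n 0
  rw [zero_add, ← real_serA_pow_mul] at h
  rw [h, coeff_zero_eq_constantCoeff_apply, map_mul, constantCoeff_real]
  simp

theorem isUnit_coord_z : IsUnit (𝒞.coord (.z 0)) := .of_mul_eq_one _ 𝒞.coord_mul_zinv

theorem isUnit_algebraMap {r : ℝ} (hr : r ≠ 0) : IsUnit (algebraMap ℝ A r) :=
  (IsUnit.mk0 r hr).map _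

/-- If `F` does not depend on the potentials beyond `u_{n+1}`, `v_{n+1}`, `w_{n+1}`, which are the
variables with the constructor index `n`, it does not depend on these either. -/
theorem pd_potential_step {F : A} (hx : 𝒞.dx F = 0) (hy : 𝒞.dy F = 0) {n : ℕ}
    (h : ∀ m, n < m →
      𝒞.pd (.u m) F = 0 ∧ 𝒞.pd (.v m) F = 0 ∧ 𝒞.pd (.w m) F = 0) :
    𝒞.pd (.u n) F = 0 ∧ 𝒞.pd (.v n) F = 0 ∧ 𝒞.pd (.w n) F = 0 := by
  -- Only `u_{n+1}`, `v_{n+1}`, `w_{n+1}` matter for a field that moves no variable of lower order.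
  have key : ∀ {D : Derivation ℝ A A} {c : Coord}, 𝒞.Annihilates D F → D (𝒞.coord (.z 0)) = 0 →
      D (𝒞.coord .x) = 0 → D (𝒞.coord .y) = 0 →
      (∀ m < n, D (𝒞.coord (.u m)) = 0 ∧ D (𝒞.coord (.v m)) = 0 ∧ D (𝒞.coord (.w m)) = 0) →
      (∀ d ∈ ({.u n, .v n, .w n} : Set Coord), d ≠ c → D (𝒞.coord d) = 0 ∨ 𝒞.pd d F = 0) →
      IsUnit (D (𝒞.coord c)) → 𝒞.pd c F = 0 := by
    intro D c hD hz hDx hDy hlt hn hc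
    refine hD.pd_eq_zero hc fun d hd => ?_
    cases d with
    | x => exact Or.inl hDx
    | y => exact Or.inl hDy
    | z i =>
      rcases i with _ | i
      · exact Or.inl hz
      · exact Or.inr (pd_z_succ_eq_zero hx i)
    | zy i => exact Or.inr (pd_zy_eq_zero hx i)
    | u m =>
      rcases lt_trichotomy m n with hm | rfl | hm
      · exact Or.inl (hlt m hm).1
      · exact hn _ (by simp) hd
      · exact Or.inr (h m hm).1
    | v m =>
      rcases lt_trichotomy m n with hm | rfl | hm
      · exact Or.inl (hlt m hm).2.1
      · exact hn _ (by simp) hd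
      · exact Or.inr (h m hm).2.1
    | w m =>
      rcases lt_trichotomy m n with hm | rfl | hm
      · exact Or.inl (hlt m hm).2.2
      · exact hn _ (by simp) hd
      · exact Or.inr (h m hm).2.2
  have dvd : ∀ r (s : A⟦X⟧), X ^ (n + 1) ∣ real A (serA ^ (n + 1) * r) * s :=
    fun r s => X_pow_dvd_real_serA_pow_mul (n + 1) r s
  -- In order `λ^(n+1)` this field acts on `v - x u` only, so that `v_{n+1}` is the only remaining
  -- variable it moves.
  have hv : 𝒞.pd (.v n) F = 0 := by
    obtain ⟨D, hD, hz, hA⟩ := exists_annihilates_pow hx (exists_annihilates_lower hx) (n + 1)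
    obtain ⟨hDx, hDy, hlt, eu, ev, ew⟩ := apply_of_X_pow_dvd (𝒞 := 𝒞) (D := D) (n := n)
      (by rw [hA.u, zero_mul, zero_add, mul_assoc]; exact (dvd _ _).mul_left _)
      (by rw [hA.v, zero_mul, sub_zero]; exact dvd _ _)
      (by rw [hA.w, zero_mul, zero_add, mul_assoc]; exact (dvd _ _).mul_left _)
      (by rw [hA.ubar, zero_mul, sub_zero]; exact dvd _ _)
    rw [hA.u, zero_mul, zero_add, mul_assoc, coeff_C_mul, coeff_real_serA_pow_mul] at eu ev
    rw [hA.v, zero_mul, sub_zero, coeff_real_serA_pow_mul] at ev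
    rw [hA.w, hA.ubar, zero_mul, zero_mul, sub_zero, zero_add, mul_assoc, coeff_C_mul,
      coeff_real_serA_pow_mul, coeff_real_serA_pow_mul] at ew
    refine key hD hz hDx hDy hlt ?_ ?_
    · rintro d (rfl | rfl | rfl) hd
      · exact Or.inl (by rw [eu]; simp)
      · exact absurd rfl hd
      · exact Or.inl (by rw [ew]; simp)
    · rw [ev]
      simpa using isUnit_algebraMap (A := A) (r := (1 / 2) ^ (n + 1) * (-1) ^ (n + 1))
        (by simp)
  -- In order `λ^(n+1)` this field acts on `w - y ū` only.
  have hw : 𝒞.pd (.w n) F = 0 := by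
    obtain ⟨D, hD, hz, hA⟩ := exists_annihilates_pow hx (exists_annihilates_upper hx hy) (n + 1)
    obtain ⟨hDx, hDy, hlt, eu, ev, ew⟩ := apply_of_X_pow_dvd (𝒞 := 𝒞) (D := D) (n := n)
      (by rw [hA.u, zero_mul, zero_add, mul_assoc]; exact (dvd _ _).mul_left _)
      (by rw [hA.v, zero_mul, sub_zero]; exact dvd _ _)
      (by rw [hA.w, zero_mul, zero_add, mul_assoc]; exact (dvd _ _).mul_left _)
      (by rw [hA.ubar, zero_mul, sub_zero]; exact dvd _ _)
    rw [hA.u, zero_mul, zero_add, mul_assoc, coeff_C_mul, coeff_real_serA_pow_mul] at eu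
    rw [hA.w, hA.ubar, zero_mul, zero_mul, sub_zero, zero_add, mul_assoc, coeff_C_mul,
      coeff_real_serA_pow_mul, coeff_real_serA_pow_mul] at ew
    refine key hD hz hDx hDy hlt ?_ ?_
    · rintro d (rfl | rfl | rfl) hd
      · exact Or.inl (by rw [eu]; simp)
      · exact Or.inr hv
      · exact absurd rfl hd
    · rw [ew]
      simpa using And.intro (isUnit_coord_z (𝒞 := 𝒞))
        (isUnit_algebraMap (A := A) (r := ((2 : ℝ) ^ (n + 1))⁻¹) (by simp))
  refine ⟨?_, hv, hw⟩
  -- The diagonal field moves `u_{n+1}`, as well as `v_{n+1}` and `w_{n+1}`, on which `F` does not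
  -- depend any more.
  obtain ⟨D, hD, hz, hA⟩ := exists_annihilates_diagonal_pow hx hy n
  obtain ⟨hDx, hDy, hlt, eu, -, -⟩ := apply_of_X_pow_dvd (𝒞 := 𝒞) (D := D) (n := n)
    (by rw [hA.u, zero_mul, add_zero, mul_assoc]; exact (dvd _ _).mul_left _)
    (by rw [hA.v, zero_mul, zero_sub, mul_assoc]; exact ((dvd _ _).mul_left _).neg_right)
    (by rw [hA.w, zero_mul, add_zero, mul_assoc]; exact (dvd _ _).mul_left _)
    (by rw [hA.ubar, zero_mul, zero_sub, mul_assoc]; exact ((dvd _ _).mul_left _).neg_right)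
  rw [hA.u, zero_mul, add_zero, mul_assoc, coeff_C_mul, coeff_real_serA_pow_mul] at eu
  refine key hD hz hDx hDy hlt ?_ ?_
  · rintro d (rfl | rfl | rfl) hd
    · exact absurd rfl hd
    · exact Or.inr hv
    · exact Or.inr hw
  · rw [eu]
    simpa using And.intro (isUnit_coord_z (𝒞 := 𝒞))
      (isUnit_algebraMap (A := A) (r := ((2 : ℝ) ^ (n + 1))⁻¹) (by simp))

theorem pd_potential_eq_zero {F : A} (hx : 𝒞.dx F = 0) (hy : 𝒞.dy F = 0)
    (n : ℕ) :
    𝒞.pd (.u n) F = 0 ∧ 𝒞.pd (.v n) F = 0 ∧ 𝒞.pd (.w n) F = 0 := by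
  obtain ⟨N₁, h₁⟩ := 𝒞.exists_forall_pd_eq_zero F .u fun m n h => by simpa using h
  obtain ⟨N₂, h₂⟩ := 𝒞.exists_forall_pd_eq_zero F .v fun m n h => by simpa using h
  obtain ⟨N₃, h₃⟩ := 𝒞.exists_forall_pd_eq_zero F .w fun m n h => by simpa using h
  have := Nat.decreasingInduction (n := max N₁ (max N₂ N₃)) (motive := fun k _ => ∀ m, k ≤ m →
      𝒞.pd (.u m) F = 0 ∧ 𝒞.pd (.v m) F = 0 ∧ 𝒞.pd (.w m) F = 0)
    (fun k _ ih m hm => by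
      rcases hm.eq_or_lt with rfl | hm
      · exact pd_potential_step hx hy ih
      · exact ih m hm)
    (fun m hm => ⟨h₁ m (by omega), h₂ m (by omega), h₃ m (by omega)⟩) (Nat.zero_le _)
  exact this n (Nat.zero_le n)

/-- A function annihilated by both total derivatives has no nonzero partial derivative. -/
theorem pd_eq_zero {F : A} (hx : 𝒞.dx F = 0) (hy : 𝒞.dy F = 0) (c : Coord) : 𝒞.pd c F = 0 := by
  have hu := fun n => (pd_potential_eq_zero hx hy n).1
  have hv := fun n => (pd_potential_eq_zero hx hy n).2.1
  have hw := fun n => (pd_potential_eq_zero hx hy n).2.2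
  have hz : 𝒞.pd (.z 0) F = 0 := by
    obtain ⟨D, hD, hDz, hA⟩ := exists_annihilates_z hx
    obtain ⟨hDx, hDy, -⟩ := apply_of_X_pow_dvd (𝒞 := 𝒞) (D := D) (n := 0)
      (by rw [hA.u, X_pow_dvd_iff]; simp)
      (by rw [hA.v, X_pow_dvd_iff]; simp)
      (by rw [hA.w, X_pow_dvd_iff]; simp)
      (by rw [hA.ubar, X_pow_dvd_iff]; simp)
    refine hD.pd_eq_zero (by rw [hDz]; exact isUnit_one) fun d hd => ?_
    cases d with
    | z i =>
      rcases i with _ | i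
      · exact absurd rfl hd
      · exact Or.inr (pd_z_succ_eq_zero hx i)
    | zy i => exact Or.inr (pd_zy_eq_zero hx i)
    | _ => simp_all
  have hz' : ∀ i, 𝒞.pd (.z i) F = 0 := by
    rintro (_ | i)
    exacts [hz, pd_z_succ_eq_zero hx i]
  have hzy := fun i => pd_zy_eq_zero hx i
  have hpx : 𝒞.pd .x F = 0 := by
    refine (Annihilates.mk chainRule_dx hx).pd_eq_zero (by simp) fun d hd => ?_
    cases d <;> simp_all
  have hpy : 𝒞.pd .y F = 0 := by
    refine (Annihilates.mk chainRule_dy hy).pd_eq_zero (by simp) fun d hd => ?_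
    cases d <;> simp_all
  cases c <;> simp_all

end CoordinateAlgebra

open PowerSeries CoordinateAlgebra

/-! ### Comparison with the coordinate formulas -/

theorem serA_eq : serA = halfParam + serB := by
  rw [serA, serB]
  linear_combination halfParam * geomSeries_mul

theorem coeff_succ_serB_mul (n : ℕ) (s : ℝ⟦X⟧) :
    coeff (n + 1) (serB * s) = 1 / 4 * ∑ i ∈ Finset.range n, coeff i s := by
  have h : serB * s = C (1 / 4) * (X ^ 2 * (s * geomSeries)) := by
    have : (C (1 / 4) : ℝ⟦X⟧) = C (1 / 2) * C (1 / 2) := by rw [← map_mul]; norm_num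
    rw [serB, halfParam, this]; ring
  rw [h, coeff_C_mul]
  congr 1
  rcases n with _ | n
  · rw [coeff_X_pow_mul']; simp
  · rw [show n + 1 + 1 = n + 2 from rfl, coeff_X_pow_mul, coeff_mul,
      Finset.Nat.sum_antidiagonal_eq_sum_range_succ
        (fun i j => coeff i s * coeff j geomSeries)]
    simp [geomSeries]

theorem coeff_succ_serA_mul (n : ℕ) (s : ℝ⟦X⟧) :
    coeff (n + 1) (serA * s) =
      1 / 2 * coeff n s + 1 / 4 * ∑ i ∈ Finset.range n, coeff i s := by
  rw [serA_eq, add_mul, map_add, coeff_succ_serB_mul, halfParam, mul_assoc, coeff_C_mul,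
    coeff_succ_X_mul]

theorem coeff_succ_serD_mul (n : ℕ) (s : ℝ⟦X⟧) :
    coeff (n + 1) (serD * s) =
      coeff (n + 1) s + 1 / 4 * ∑ i ∈ Finset.range n, coeff i s := by
  rw [serD_eq, add_mul, one_mul, map_add, coeff_succ_serB_mul]

/-- The recursion for `ū` as an equation between generating series. -/
theorem ubar_generating (P : Pt) :
    ((1 - halfParam) * PowerSeries.mk (uPot P)
      + halfParam * C (P .y) * (PowerSeries.mk (vPot P) - C (P .x) * PowerSeries.mk (uPot P)))
      * PowerSeries.mk (ubar P) =
    1 + halfParam * (PowerSeries.mk (vPot P) - C (P .x) * PowerSeries.mk (uPot P))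
      * PowerSeries.mk (wPot P) := by
  have conv : ∀ (f g : ℕ → ℝ) (k : ℕ),
      coeff k (PowerSeries.mk f * PowerSeries.mk g) = ∑ i : Fin (k + 1), f i * g (k - i) := by
    intro f g k
    rw [coeff_mul, Finset.Nat.sum_antidiagonal_eq_sum_range_succ
      (fun i j => coeff i (PowerSeries.mk f) * coeff j (PowerSeries.mk g)), ← Fin.sum_univ_eq_sum_range
      (fun i => coeff i (PowerSeries.mk f) * coeff (k - i) (PowerSeries.mk g))]
    simp
  have e : ∀ p q r s : ℝ⟦X⟧, ((1 - halfParam) * p + halfParam * C (P .y) * (q - C (P .x) * p)) * r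
      - (1 + halfParam * (q - C (P .x) * p) * s)
      = p * r - 1 - C (1 / 2) * (X * (C (1 + P .x * P .y) * (p * r) - C (P .y) * (r * q)
        + (q - C (P .x) * p) * s)) := by
    intro p q r s
    rw [halfParam, map_add, map_mul, map_one]; ring
  rw [← sub_eq_zero, e]
  ext n
  rcases n with _ | n
  · simp [uPot, ubar]
  · have hsub : (PowerSeries.mk (vPot P) - C (P .x) * PowerSeries.mk (uPot P)) =
        PowerSeries.mk fun i => vPot P i - P .x * uPot P i := by
      ext i; simp
    have h1 : coeff (n + 1) (1 : ℝ⟦X⟧) = 0 := by simp [coeff_one]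
    rw [hsub, map_sub, map_sub, h1, coeff_C_mul, coeff_succ_X_mul, map_add, map_sub, coeff_C_mul,
      coeff_C_mul, conv, conv, conv, conv, Fin.sum_univ_succ]
    simp only [Fin.val_zero, Fin.val_succ, Nat.sub_zero, Nat.add_sub_add_right, map_zero]
    rw [ubar, show uPot P 0 = 1 from rfl]
    ring

section Domain

variable {U : Set Pt} (hU : IsOpen U) (hz : ∀ P ∈ U, P (.z 0) ≠ 0)

/-- The coordinate algebra of a domain on which `z` does not vanish. -/
noncomputable def domainAlgebra : CoordinateAlgebra (smoothAlgebra U) where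
  coord c := smoothAlgebra.mk (fun P => P c) (isSmoothFinitaryOn_coord c)
  pd := smoothAlgebra.pd hU
  pd_coord c d := by
    refine smoothAlgebra.ext_eval fun P => ?_
    rw [smoothAlgebra.pd_mk, pderiv]
    split_ifs with h
    · subst h; simp
    · simp [Function.update_of_ne h]
  pd_comm c d F := by
    refine smoothAlgebra.ext_eval fun P => ?_
    refine (smoothAlgebra.pd_mk hU c _ (F.2.pderiv hU d) P).trans ?_
    refine Eq.trans ?_ (smoothAlgebra.pd_mk hU d _ (F.2.pderiv hU c) P).symm
    exact F.2.pderiv_comm hU P.2 c d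
  exists_pd_eq_zero F := by
    obtain ⟨s, hs⟩ := F.2.exists_pderiv_eq_zero hU
    exact ⟨s, fun c hc => smoothAlgebra.ext_eval fun P => hs c hc P P.2⟩
  zinv := smoothAlgebra.mk (fun P => (P (.z 0))⁻¹) (isSmoothFinitaryOn_inv_coord hz)
  coord_mul_zinv := smoothAlgebra.ext_eval fun P => by
    rw [map_mul, map_one]
    exact mul_inv_cancel₀ (hz P P.2)

/-- The value at a point of a power series of functions. -/
noncomputable abbrev evalSeries (P : U) : (smoothAlgebra U)⟦X⟧ →+* ℝ⟦X⟧ :=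
  PowerSeries.map (smoothAlgebra.eval P : smoothAlgebra U →+* ℝ)

@[simp]
theorem eval_coord (P : U) (c : Coord) :
    smoothAlgebra.eval P ((domainAlgebra hU hz).coord c) = P.1 c := rfl

@[simp]
theorem eval_zinv (P : U) :
    smoothAlgebra.eval P (domainAlgebra hU hz).zinv = (P.1 (.z 0))⁻¹ := rfl

theorem evalSeries_real (P : U) (p : ℝ⟦X⟧) : evalSeries P (real (smoothAlgebra U) p) = p := by
  ext n; simp

theorem evalSeries_C (P : U) (g : smoothAlgebra U) :
    evalSeries P (C g) = C (smoothAlgebra.eval P g) := by simp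

theorem evalSeries_uSeries (P : U) :
    evalSeries P (domainAlgebra hU hz).uSeries = PowerSeries.mk (uPot P.1) := by
  ext n; rcases n with _ | n <;> simp [uPot]

theorem evalSeries_vSeries (P : U) :
    evalSeries P (domainAlgebra hU hz).vSeries = PowerSeries.mk (vPot P.1) := by
  ext n; rcases n with _ | n <;> simp [vPot]

theorem evalSeries_wSeries (P : U) :
    evalSeries P (domainAlgebra hU hz).wSeries = PowerSeries.mk (wPot P.1) := by
  ext n; rcases n with _ | n <;> simp [wPot]

theorem evalSeries_vShift (P : U) : evalSeries P (domainAlgebra hU hz).vShift =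
    PowerSeries.mk (vPot P.1) - C (P.1 .x) * PowerSeries.mk (uPot P.1) := by
  rw [vShift, map_sub, map_mul, evalSeries_C, evalSeries_uSeries, evalSeries_vSeries, eval_coord]

theorem evalSeries_ubarSeries (P : U) :
    evalSeries P (domainAlgebra hU hz).ubarSeries = PowerSeries.mk (ubar P.1) := by
  have h := congrArg (evalSeries P) (domainAlgebra hU hz).ubarFactor_mul_ubarSeries
  refine ((domainAlgebra hU hz).isUnit_ubarFactor.map (evalSeries P)).mul_left_cancel ?_
  rw [map_mul] at h
  rw [h]
  simp only [ubarFactor, map_add, map_sub, map_mul, map_one, evalSeries_real, evalSeries_C,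
    evalSeries_uSeries, evalSeries_wSeries, evalSeries_vShift, eval_coord]
  exact (ubar_generating P.1).symm

theorem evalSeries_wShift (P : U) : evalSeries P (domainAlgebra hU hz).wShift =
    PowerSeries.mk (wPot P.1) - C (P.1 .y) * PowerSeries.mk (ubar P.1) := by
  rw [wShift, map_sub, map_mul, evalSeries_C, evalSeries_ubarSeries, evalSeries_wSeries,
    eval_coord]

theorem eval_coeff (P : U) (n : ℕ) (p : (smoothAlgebra U)⟦X⟧) :
    smoothAlgebra.eval P (coeff n p) = coeff n (evalSeries P p) := (coeff_map _ _ _).symm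

theorem evalSeries_xDiag (P : U) : evalSeries P (domainAlgebra hU hz).xDiag =
    C (-(1 / 2 * P.1 (.zy 0))) * serA + C (-(1 / 2 * P.1 (.z 1) / P.1 (.z 0))) * serB := by
  simp only [xDiag, map_add, map_mul, map_neg, evalSeries_real, evalSeries_C, eval_coord,
    eval_zinv, div_eq_mul_inv]
  ring

theorem evalSeries_yDiag (P : U) : evalSeries P (domainAlgebra hU hz).yDiag =
    C (-(1 / 2 * P.1 (.z 1) / P.1 (.z 0) ^ 2)) * serA
      + C (-(1 / 2 * P.1 (.zy 0) / P.1 (.z 0))) * serB := by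
  simp only [yDiag, map_add, map_mul, map_neg, map_pow, evalSeries_real, evalSeries_C, eval_coord,
    eval_zinv, div_eq_mul_inv]
  rw [← inv_pow, map_pow]
  ring

/-- The components of the algebraic total derivative in the direction `x` are the given ones. -/
theorem eval_dx_coord (P : U) (c : Coord) :
    smoothAlgebra.eval P ((domainAlgebra hU hz).dx ((domainAlgebra hU hz).coord c)) =
      xCoeff c P.1 := by
  have hzP := hz P.1 P.2
  cases c with
  | x => rw [dx_x, map_one]; rfl
  | y => rw [dx_y, map_zero]; rfl
  | z i => rw [dx_z]; rfl
  | zy i => rw [dx_zy]; rfl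
  | u n =>
    rw [dx, vf_coord]
    simp only [coverCoeff, eval_coeff, map_add (evalSeries P), map_mul (evalSeries P),
      map_neg (evalSeries P), evalSeries_real, evalSeries_C, evalSeries_uSeries,
      evalSeries_vShift, evalSeries_xDiag, eval_coord]
    simp only [add_mul, neg_mul, mul_assoc, map_add, map_sub, map_neg, coeff_C_mul,
      coeff_succ_serA_mul, coeff_succ_serB_mul, coeff_mk, Finset.sum_sub_distrib,
      ← Finset.mul_sum, xCoeff, ux, K₁, L₁]
    field_simp
    ring
  | v n =>
    rw [dx, vf_coord]
    simp only [coverCoeff, eval_coeff, map_add (evalSeries P), map_sub (evalSeries P),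
      map_mul (evalSeries P), map_neg (evalSeries P), evalSeries_real, evalSeries_C,
      evalSeries_uSeries, evalSeries_vShift, evalSeries_xDiag, eval_coord, map_one]
    simp only [add_mul, neg_mul, mul_assoc, map_add, map_sub, map_neg, coeff_C_mul,
      coeff_succ_serA_mul, coeff_succ_serB_mul, coeff_succ_serD_mul, coeff_mk,
      Finset.sum_sub_distrib, ← Finset.mul_sum, xCoeff, vx, K₁, L₁, K₂, L₂, one_mul,
      show ∀ P n, uPot P (n + 1) = P (.u n) from fun _ _ => rfl]
    field_simp
    ring
  | w n =>
    rw [dx, vf_coord]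
    simp only [coverCoeff, eval_coeff, map_add (evalSeries P), map_sub (evalSeries P),
      map_mul (evalSeries P), map_neg (evalSeries P), evalSeries_real, evalSeries_C,
      evalSeries_ubarSeries, evalSeries_wShift, evalSeries_xDiag, eval_coord, map_zero]
    simp only [add_mul, neg_mul, mul_assoc, map_add, map_sub, map_neg, coeff_C_mul,
      coeff_succ_serA_mul, coeff_succ_serB_mul, coeff_mk, Finset.sum_sub_distrib,
      ← Finset.mul_sum, xCoeff, wx, Kbar₁, Lbar₁, Kbar₂, Lbar₂, zero_mul, map_zero]
    field_simp
    ring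

/-- The components of the algebraic total derivative in the direction `y` are the given ones, but
for those along the jet coordinates `z_{x…xy}`. -/
theorem eval_dy_coord (P : U) (c : Coord) (hc : ∀ i, c ≠ .zy i) :
    smoothAlgebra.eval P ((domainAlgebra hU hz).dy ((domainAlgebra hU hz).coord c)) =
      yCoeff c P.1 := by
  have hzP := hz P.1 P.2
  cases c with
  | x => rw [dy_x, map_zero]; rfl
  | y => rw [dy_y, map_one]; rfl
  | z i => rw [dy_z]; rfl
  | zy i => exact absurd rfl (hc i)
  | u n =>
    rw [dy, vf_coord]
    simp only [coverCoeff, eval_coeff, map_add (evalSeries P), map_mul (evalSeries P),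
      map_neg (evalSeries P), evalSeries_real, evalSeries_uSeries, evalSeries_vShift,
      evalSeries_yDiag]
    simp only [add_mul, neg_mul, mul_assoc, map_add, map_sub, map_neg, coeff_C_mul,
      coeff_succ_serA_mul, coeff_succ_serB_mul, coeff_mk, Finset.sum_sub_distrib,
      ← Finset.mul_sum, yCoeff, uy, K₁, L₁]
    field_simp
    ring
  | v n =>
    rw [dy, vf_coord]
    simp only [coverCoeff, eval_coeff, map_add (evalSeries P), map_sub (evalSeries P),
      map_mul (evalSeries P), map_neg (evalSeries P), evalSeries_real, evalSeries_C,
      evalSeries_uSeries, evalSeries_vShift, evalSeries_yDiag, eval_coord, eval_zinv, map_zero]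
    simp only [add_mul, neg_mul, mul_assoc, map_add, map_sub, map_neg, coeff_C_mul,
      coeff_succ_serA_mul, coeff_succ_serB_mul, coeff_mk, Finset.sum_sub_distrib,
      ← Finset.mul_sum, yCoeff, vy, K₁, L₁, K₂, L₂, zero_mul, map_zero]
    field_simp
    ring
  | w n =>
    rw [dy, vf_coord]
    simp only [coverCoeff, eval_coeff, map_add (evalSeries P), map_sub (evalSeries P),
      map_mul (evalSeries P), map_neg (evalSeries P), evalSeries_real, evalSeries_C,
      evalSeries_ubarSeries, evalSeries_wShift, evalSeries_yDiag, eval_coord, eval_zinv, map_one]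
    simp only [add_mul, neg_mul, mul_assoc, map_add, map_sub, map_neg, coeff_C_mul,
      coeff_succ_serA_mul, coeff_succ_serB_mul, coeff_succ_serD_mul, coeff_mk,
      Finset.sum_sub_distrib, ← Finset.mul_sum, yCoeff, wy, Kbar₁, Lbar₁, Kbar₂, Lbar₂, one_mul]
    field_simp
    ring

theorem exists_eq_const_of_totalD (hU : IsOpen U) (hz : ∀ P ∈ U, P (.z 0) ≠ 0)
    {F : Pt → ℝ} (hc : IsPreconnected U) (hF : IsSmoothFinitaryOn F U)
    (hx : ∀ P ∈ U, totalDx F P = 0) (hy : ∀ P ∈ U, totalDy F P = 0) :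
    ∃ c : ℝ, ∀ P ∈ U, F P = c := by
  set 𝒞 := domainAlgebra hU hz with h𝒞
  set G : smoothAlgebra U := smoothAlgebra.mk F hF with hG
  have hpd : ∀ (P : U) c, smoothAlgebra.eval P (𝒞.pd c G) = pderiv c F P := fun P c =>
    smoothAlgebra.pd_mk hU c F hF P
  obtain ⟨s, hs⟩ := 𝒞.exists_pd_eq_zero G
  have hsum : ∀ (P : U) (a : Coord → Pt → ℝ),
      vectorField a F P = ∑ c ∈ s, a c P * smoothAlgebra.eval P (𝒞.pd c G) := by
    intro P a
    simp only [hpd]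
    refine finsum_eq_sum_of_support_subset _ fun c h => ?_
    by_contra hcs
    refine h ?_
    simp only [← hpd, hs c hcs, map_zero, mul_zero]
  have hdx : 𝒞.dx G = 0 := smoothAlgebra.ext_eval fun P => by
    rw [map_zero, ← hx P P.2, totalDx, hsum, chainRule_dx.eq_sum hs, map_sum]
    refine Finset.sum_congr rfl fun c _ => ?_
    rw [map_mul, eval_dx_coord]
  have hdy : 𝒞.dy G = 0 := smoothAlgebra.ext_eval fun P => by
    rw [map_zero, ← hy P P.2, totalDy, hsum, chainRule_dy.eq_sum hs, map_sum]
    refine Finset.sum_congr rfl fun c _ => ?_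
    rw [map_mul]
    by_cases h : ∃ i, c = .zy i
    · -- the component along `z_{x…xy}` is irrelevant since `F` does not depend on it
      obtain ⟨i, rfl⟩ := h
      rw [pd_zy_eq_zero hdx, map_zero, mul_zero, mul_zero]
    · rw [eval_dy_coord hU hz P c fun i hi => h ⟨i, hi⟩]
  refine hF.exists_eq_const hU hc fun c P hP => ?_
  rw [← hpd ⟨P, hP⟩, pd_eq_zero hdx hdy, map_zero]

end Domain

end ConstAstig

/-- Over every connected open domain on which `z ≠ 0`, a smooth function of finitely many of the
variables annihilated by both total derivatives is constant; in particular the covering is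
differentially connected over each of the two components `z > 0` and `z < 0` of its total
space. -/
theorem mainTheorem1 :
    (∀ (U : Set ConstAstig.Pt), IsOpen U → IsPreconnected U →
      (∀ P ∈ U, P (ConstAstig.Coord.z 0) ≠ 0) →
      ∀ F : ConstAstig.Pt → ℝ, ConstAstig.IsSmoothFinitaryOn F U →
        (∀ P ∈ U, ConstAstig.totalDx F P = 0) →
        (∀ P ∈ U, ConstAstig.totalDy F P = 0) →
        ∃ c : ℝ, ∀ P ∈ U, F P = c) ∧
    ConstAstig.DifferentiallyConnectedOn {P | 0 < P (ConstAstig.Coord.z 0)} ∧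
    ConstAstig.DifferentiallyConnectedOn {P | P (ConstAstig.Coord.z 0) < 0} := by
  refine ⟨fun U hU hc hz F hF hx hy => ConstAstig.exists_eq_const_of_totalD hU hz hc hF hx hy,
    fun F hF hx hy => ?_, fun F hF hx hy => ?_⟩
  · refine ConstAstig.exists_eq_const_of_totalD (isOpen_lt continuous_const (continuous_apply _))
      (fun P hP => ne_of_gt hP) (Convex.isPreconnected ?_) hF hx hy
    exact convex_halfSpace_gt (LinearMap.proj (R := ℝ) (φ := fun _ => ℝ) _).isLinear 0
  · refine ConstAstig.exists_eq_const_of_totalD (isOpen_lt (continuous_apply _) continuous_const)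
      (fun P hP => ne_of_lt hP) (Convex.isPreconnected ?_) hF hx hy
    exact convex_halfSpace_lt (LinearMap.proj (R := ℝ) (φ := fun _ => ℝ) _).isLinear 0
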